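/- Let $0<p<q\le\pi$ and put $A=\sin p$, $B=\sin(q-p)$. Let $\alpha\in(0,\pi)$ and $\beta\in(0,\pi/2)$ be given by $$\tan^2\frac{\alpha}{2}=\frac{A}{B},\qquad \tan\beta=\frac{\sin(q/2)}{\cos(q/2-p)},$$ and let $Q=Q_{p,q}\subset\mathbb C$ be the open bicentric quadrilateral with the vertices $$P_1=e^{i(q-p+2\beta)},\quad P_2=e^{-ip},\quad P_3=e^{i(p-q+2\beta)},\quad P_4=e^{ip}.$$ The pair $(p,q)$ is called admissible if $0\in Q$. Let $\mathbb D$ be the unit disk, and let $f=f_{p,q}$ be the harmonic (Poisson) extension to $\mathbb D$ of the step function on the unit circle that takes the values $P_1,P_2,P_3,P_4$ on the arcs $\{e^{it}\}$ with $t$ in $(0,\alpha)$, $(\alpha,\pi)$, $(\pi,\pi+\alpha)$, $(\pi+\alpha,2\pi)$, respectively. A Scherk-type comparison graph with the parameters $(p,q)$ is the graph of a $C^2$ solution $u:Q\to\mathbb R$ of the minimal surface equation such that $f$ maps $\mathbb D$ bijectively onto $Q$ and $z\mapsto (f(z),u(f(z)))$ is a harmonic isothermal (conformal) parametrization of the graph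 by $\mathbb D$. Write $W=\sqrt{1+|\nabla u|^2}$ and $K=\dfrac{u_{xx}u_{yy}-u_{xy}^2}{(1+u_x^2+u_y^2)^2}$ for its inclination factor and its Gaussian curvature; its distinguished point is the point above $0$. **Proposition (Lower bound).** For every admissible pair $(p,q)$ and every Scherk-type comparison graph with the parameters $(p,q)$, $$W^2|K|\ \ge\ \frac{\pi^2}{4}\qquad\text{at the distinguished point.}$$ Consequently, together with the upper bound for this family, $$\frac{\pi^2}{4}\ \le\ W^2|K|\ \le\ \frac{\pi^2}{2}$$ at the distinguished point, throughout the family. -/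

import Mathlib

open Set MeasureTheory

noncomputable section

namespace Scherk

/-! ### Graphs over planar domains (the plane is identified with `ℂ`) -/

section Graphs

variable {E : Type*} [NormedAddCommGroup E] [NormedSpace ℝ E]

/-- Partial derivative in the real direction. -/
def dx (F : ℂ → E) (z : ℂ) : E := fderiv ℝ F z 1

/-- Partial derivative in the imaginary direction. -/
def dy (F : ℂ → E) (z : ℂ) : E := fderiv ℝ F z Complex.I

end Graphs

/-- The inclination factor `W = √(1 + |∇u|²)` of the graph of `u`, at the point above `z`. -/
def inclination (u : ℂ → ℝ) (z : ℂ) : ℝ := Real.sqrt (1 + dx u z ^ 2 + dy u z ^ 2)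

/-- The Gaussian curvature of the graph of `u`, at the point above `z`. -/
def gaussCurvature (u : ℂ → ℝ) (z : ℂ) : ℝ :=
  (dx (dx u) z * dy (dy u) z - dy (dx u) z ^ 2) / (1 + dx u z ^ 2 + dy u z ^ 2) ^ 2

/-- `u` is a `C²` solution of the minimal surface equation on (the open set) `D`. -/
def IsMinimalGraphOn (u : ℂ → ℝ) (D : Set ℂ) : Prop :=
  ContDiffOn ℝ 2 u D ∧
    ∀ z ∈ D, (1 + dy u z ^ 2) * dx (dx u) z - 2 * dx u z * dy u z * dy (dx u) z
      + (1 + dx u z ^ 2) * dy (dy u) z = 0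

/-- The map `z ↦ (f z, h z)` into `ℂ × ℝ = ℝ³` is isothermal (conformal) at `z`: its two partial
derivatives are orthogonal and have the same length. -/
def IsIsothermalAt (f : ℂ → ℂ) (h : ℂ → ℝ) (z : ℂ) : Prop :=
  ‖dx f z‖ ^ 2 + dx h z ^ 2 = ‖dy f z‖ ^ 2 + dy h z ^ 2 ∧
    inner ℝ (dx f z) (dy f z) + dx h z * dy h z = 0

/-! ### The two-parameter family -/

/-- Harmonic measure, seen from the point `z` of the unit disk, of the boundary arc
`{exp (i t) : a < t < b}`. -/
def harmonicMeasure (a b : ℝ) (z : ℂ) : ℝ :=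
  (2 * Real.pi)⁻¹ * ∫ t in a..b, poissonKernel 0 z (circleMap 0 1 t)

/-- The arc parameter `α ∈ (0, π)`, `tan² (α / 2) = sin p / sin (q - p)`. -/
def arcAngle (p q : ℝ) : ℝ := 2 * Real.arctan (Real.sqrt (Real.sin p / Real.sin (q - p)))

/-- The angle `β ∈ (0, π / 2)`, `tan β = sin (q / 2) / cos (q / 2 - p)`. It is the angle for which
the cyclic quadrilateral with the vertices below has equal sums of opposite sides, that is, for
which it is bicentric. -/
def halfTilt (p q : ℝ) : ℝ := Real.arctan (Real.sin (q / 2) / Real.cos (q / 2 - p))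

/-- The four vertices `P₁, P₂, P₃, P₄`, on the unit circle, of the bicentric quadrilateral. -/
def vertex (p q : ℝ) : Fin 4 → ℂ :=
  ![Complex.exp ((q - p + 2 * halfTilt p q : ℝ) * Complex.I),
    Complex.exp ((-p : ℝ) * Complex.I),
    Complex.exp ((p - q + 2 * halfTilt p q : ℝ) * Complex.I),
    Complex.exp ((p : ℝ) * Complex.I)]

/-- The (open) bicentric quadrilateral. -/
def quadrilateral (p q : ℝ) : Set ℂ := interior (convexHull ℝ (range (vertex p q)))

/-- Harmonic extension to the unit disk of the step function with the values `P₁, P₂, P₃, P₄` on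
the arcs `(0, α)`, `(α, π)`, `(π, π + α)`, `(π + α, 2π)`. -/
def horizontalProjection (p q : ℝ) (z : ℂ) : ℂ :=
  harmonicMeasure 0 (arcAngle p q) z • vertex p q 0
    + harmonicMeasure (arcAngle p q) Real.pi z • vertex p q 1
    + harmonicMeasure Real.pi (Real.pi + arcAngle p q) z • vertex p q 2
    + harmonicMeasure (Real.pi + arcAngle p q) (2 * Real.pi) z • vertex p q 3

/-- Admissible pairs: those for which the quadrilateral contains the center of the unit disk. -/
def Admissible (p q : ℝ) : Prop :=
  0 < p ∧ p < q ∧ q ≤ Real.pi ∧ (0 : ℂ) ∈ quadrilateral p q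

/-- `u` is the height function of a Scherk-type comparison graph with parameters `p, q`: a minimal
graph over the quadrilateral which has an isothermal harmonic parametrization by the unit disk
whose horizontal projection is the harmonic extension of the four-step boundary function. -/
structure IsScherkGraph (p q : ℝ) (u : ℂ → ℝ) : Prop where
  minimal : IsMinimalGraphOn u (quadrilateral p q)
  bijOn : BijOn (horizontalProjection p q) (Metric.ball 0 1) (quadrilateral p q)
  harmonic : InnerProductSpace.HarmonicOnNhd (fun z => u (horizontalProjection p q z))
    (Metric.ball 0 1)
  isothermal : ∀ z ∈ Metric.ball (0 : ℂ) 1,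
    IsIsothermalAt (horizontalProjection p q) (fun z => u (horizontalProjection p q z)) z

end Scherk

end

namespace Scherk

/-! ### The trigonometric inequality -/

section TrigInequality

open Real

/-! Write `X = sin p`, `Y = sin (q - p)`, `c = cos p`, `d = cos (q - p)`, `N = 1 + X * Y`. The
derivatives `f_z` and `conj f_z̄` of the four-step map are quadratics over `(z² - 1)(z² - E⁴)`, with
`E = exp (iα/2)`. The choice of `α` and `β` makes the discriminant of these quadratics vanish, so
`f_z = H k²` and `conj f_z̄ = -E⁴ H j²` with `k = l z + m` and `j = conj l + conj m * z`
(`exists_sqrt_data`, `vertex_sqrt_data`).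

Conformality then says that the complex gradient of the height `u ∘ f` has the square `(2E²Hkj)²`.
As it is holomorphic, it equals `± 2E²Hkj` throughout the disk. Solving the chain rule for the
gradient of `u` shows that it is `2r / (1 - |r|²)`, up to a unimodular constant, with the Möbius map
`r = j / k`. Comparing Jacobians gives `W²|K| = 4|r'|² / (|f_z|² (1 - |r|⁴)²)`. In terms of the
numbers `m₁, …, m₄`, which are `π` times the harmonic measures of the arcs at `z`, this is `π² N /
T²`, where `T` is `slopeSum` (`IsScherkGraph.curvature_eq`).

At the point over `0` the weights balance, `∑ m_k P_k = 0`. This expresses `δ = m₁ - m₃` and `ε = m₂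
- m₄` through `a = m₁ + m₃`. A relation between the sines of the weights, coming from the positions
of the four jumps, supplies one more equation. What remains is the trigonometric estimate `√(2N) ≤ T
≤ 2√N` (`slopeSum_bounds`): its right half is the lower curvature bound and its left half the upper
one. -/

theorem le_one_of_sq_add_sq_eq_one {x y : ℝ} (h : x ^ 2 + y ^ 2 = 1) : x ≤ 1 := by
  nlinarith [sq_nonneg y]

theorem sqrt_sq_add_le {G D s : ℝ} (hG : 0 < G) (hD : 0 ≤ D) (hs : G + D / (2 * G) ≤ s) :
    √(G ^ 2 + D) ≤ s := by
  refine (Real.sqrt_le_left (by positivity)).2 ?_ |>.trans hs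
  have : (G + D / (2 * G)) ^ 2 = G ^ 2 + D + (D / (2 * G)) ^ 2 := by field_simp; ring
  rw [this]
  linarith [sq_nonneg (D / (2 * G))]

/-- Every term on the left is bounded by a function of `r` alone, and a polynomial inequality in `r`
is left. That inequality fails as `r` tends to `1`; the hypothesis `1/4 ≤ D` keeps `r` below about
`√3/2`. -/
theorem defect_le_of_large {D G Y r t : ℝ} (hr0 : 0 ≤ r) (hr : r ^ 2 = 1 - D) (hD : 1 / 4 ≤ D)
    (hG : 1 + r ≤ G) (hrY : r ≤ Y) (hY1 : Y ≤ 1) (ht0 : 0 ≤ t) (ht : (G + Y) * t ≤ r) :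
    D / (2 * G) + t * Y * D + t ^ 2 * G / 1.94 ≤ D := by
  have hr1 : r ≤ 0.8661 := by nlinarith
  have hGpos : 0 < G := by linarith
  have h1 : D / (2 * G) ≤ D / (2 * (1 + r)) := by gcongr
  have h2 : t * Y ≤ r / (2 + r) := by
    rw [le_div_iff₀ (by positivity)]
    nlinarith [mul_nonneg ht0 (sub_nonneg.2 hG),
      mul_nonneg ht0 (mul_nonneg (sub_nonneg.2 hY1) (by linarith : 0 ≤ 1 + r))]
  have ht1 : t ≤ r / (1 + 2 * r) := by
    rw [le_div_iff₀ (by positivity)]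
    nlinarith [mul_nonneg ht0 (sub_nonneg.2 hG), mul_nonneg ht0 (sub_nonneg.2 hrY)]
  have ht2 : r / (1 + 2 * r) ≤ 1 / 2 := by
    rw [div_le_div_iff₀ (by positivity) (by positivity)]; linarith
  have h3 : t ^ 2 * G ≤ (1 + r) * r ^ 2 / (1 + 2 * r) ^ 2 := by
    have e1 : t ^ 2 * G ≤ r * (t * (1 - t)) := by
      nlinarith [mul_nonneg ht0 (sub_nonneg.2 ht),
        mul_nonneg ht0 (mul_nonneg ht0 (sub_nonneg.2 hrY))]
    -- The function `x (1 - x)` increases on `[0, 1/2]`.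
    have e2 : t * (1 - t) ≤ r / (1 + 2 * r) * (1 - r / (1 + 2 * r)) := by nlinarith
    have e3 : r * (r / (1 + 2 * r) * (1 - r / (1 + 2 * r)))
        = (1 + r) * r ^ 2 / (1 + 2 * r) ^ 2 := by field_simp; ring
    exact e1.trans ((mul_le_mul_of_nonneg_left e2 hr0).trans e3.le)
  have h4 : D / (2 * (1 + r)) + r / (2 + r) * D + (1 + r) * r ^ 2 / (1 + 2 * r) ^ 2 / 1.94 ≤ D := by
    obtain rfl : D = (1 - r) * (1 + r) := by linarith
    have key : 2 * r ^ 2 * (1 + r) * (2 + r) ≤ (1 - r) * (2 + 3 * r) * (1.94 * (1 + 2 * r) ^ 2) := by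
      nlinarith [mul_nonneg hr0 (sub_nonneg.2 hr1), mul_nonneg (mul_nonneg hr0 hr0) (sub_nonneg.2 hr1),
        mul_nonneg (mul_nonneg (mul_nonneg hr0 hr0) hr0) (sub_nonneg.2 hr1)]
    have e : (1 - r) * (1 + r) - ((1 - r) * (1 + r) / (2 * (1 + r))
        + r / (2 + r) * ((1 - r) * (1 + r)) + (1 + r) * r ^ 2 / (1 + 2 * r) ^ 2 / 1.94)
        = ((1 - r) * (2 + 3 * r) * (1.94 * (1 + 2 * r) ^ 2) - 2 * r ^ 2 * (1 + r) * (2 + r))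
          / (2 * (2 + r) * (1.94 * (1 + 2 * r) ^ 2)) := by
      field_simp; ring
    have : 0 ≤ ((1 - r) * (2 + 3 * r) * (1.94 * (1 + 2 * r) ^ 2) - 2 * r ^ 2 * (1 + r) * (2 + r))
          / (2 * (2 + r) * (1.94 * (1 + 2 * r) ^ 2)) := div_nonneg (by linarith) (by positivity)
    linarith
  have h5 : t * Y * D ≤ r / (2 + r) * D := by gcongr
  have h6 : t ^ 2 * G / 1.94 ≤ (1 + r) * r ^ 2 / (1 + 2 * r) ^ 2 / 1.94 := by gcongr
  linarith

/-- Here `t` itself is of order `D`, so the three terms are at most about `0.27 D`, `0.25 D` and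
`0.24 D`. -/
theorem defect_le_of_small {D G Y t : ℝ} (hD0 : 0 ≤ D) (hD : D ≤ 1 / 4)
    (hG : 1.866 ≤ G) (hY0 : 0 ≤ Y) (hY1 : Y ≤ 1) (ht0 : 0 ≤ t) (ht : G * t ≤ 1.84 * D) :
    D / (2 * G) + t * Y * D + t ^ 2 * G / 1.94 ≤ D := by
  have ht1 : t ≤ 0.99 * D := by nlinarith
  have h1 : D / (2 * G) ≤ D / (2 * 1.866) := by gcongr
  have h2 : t * Y ≤ 1 / 4 := by nlinarith
  have h3 : t * Y * D ≤ 1 / 4 * D := by gcongr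
  have h4 : t ^ 2 * G ≤ 0.46 * D := by nlinarith [mul_nonneg ht0 (sub_nonneg.2 ht)]
  norm_num at h1 ⊢
  linarith

/-- Jordan's inequality `sin δ ≥ 2δ/π` turns the linear formula for `δ` into a bound for its sine.
-/
theorem mul_sin_ge_of_mul_eq {X Y c b δ : ℝ} (hX : 0 < X) (hY : 0 < Y) (hc : 0 ≤ c)
    (hX1 : X ≤ 1) (hY1 : Y ≤ 1) (hδ0 : 0 ≤ δ) (hδ : δ ≤ π / 2)
    (hδe : δ * (Y * (X + Y)) = c * (π * (1 + X * Y) - (π / 2 + b) * (Y * (X + Y)))) :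
    c * (1 - 2 / π * b * Y) ≤ Y * sin δ := by
  have hπ := pi_pos
  have h1 : 2 / π * δ ≤ sin δ := mul_le_sin hδ0 hδ
  have h2 : Y * (2 / π * δ) = c * (2 * (1 + X * Y) / (X + Y) - Y - 2 / π * b * Y) := by
    field_simp
    linear_combination 2 * hδe
  have h3 : 1 + Y ≤ 2 * (1 + X * Y) / (X + Y) := by
    rw [le_div_iff₀ (by positivity)]
    nlinarith [mul_nonneg (sub_nonneg.2 hX1) (sub_nonneg.2 hY1)]
  calc c * (1 - 2 / π * b * Y) ≤ c * (2 * (1 + X * Y) / (X + Y) - Y - 2 / π * b * Y) := by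
        gcongr; linarith
    _ = Y * (2 / π * δ) := h2.symm
    _ ≤ Y * sin δ := by gcongr

/-- The left side is at most `(1 - Y) + Y δ²/2`. The first term is at most `d²`. As `Y δ ≤ 1.7825 c`
and `Y ≥ 0.866`, the second is at most `1.84 c²`. -/
theorem mul_sub_mul_cos_le {X Y G D c d b δ ε : ℝ} (hc : 0 ≤ c) (hX1 : X ≤ 1)
    (hXY : X + Y = G) (hYd : Y ^ 2 + d ^ 2 = 1)
    (hD : c ^ 2 + d ^ 2 = D) (hGD : 2 * (1 + X * Y) = G ^ 2 + D) (hD4 : D ≤ 1 / 4)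
    (hG2 : 1.866 ≤ G) (hYr : 0.866 ≤ Y) (hY1 : Y ≤ 1) (hb : 0 ≤ b) (hδ0 : 0 ≤ δ)
    (hδe : δ * (Y * (X + Y)) = c * (π * (1 + X * Y) - (π / 2 + b) * (Y * (X + Y))))
    (hcε : 0 ≤ cos ε) : X * cos ε - Y * cos δ ≤ 1.84 * D := by
  have hG : 0 < G := by linarith
  have hY : 0 < Y := by linarith
  have h1 : Y * δ ≤ 1.7825 * c := by
    have h2 : Y * δ = c * (π / 2 * (X + D / G) - b * Y) := by
      have e : Y * δ * G = c * (π / 2 * (X + D / G) - b * Y) * G := by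
        have : δ * (Y * G) = c * (π * ((G ^ 2 + D) / 2) - (π / 2 + b) * (Y * G)) := by
          rw [← hGD, ← hXY, hδe]; ring
        field_simp
        rw [← hXY] at this ⊢
        linear_combination 2 * this
      exact mul_right_cancel₀ hG.ne' e
    have h3 : D / G ≤ 0.134 := by
      rw [div_le_iff₀ hG]; linarith
    have h4 : π / 2 * (X + D / G) ≤ 1.7825 := by
      have := pi_lt_d4
      have := pi_pos
      have : 0 ≤ X := by linarith
      have : 0 ≤ D / G := div_nonneg (hD ▸ by positivity) hG.le
      calc π / 2 * (X + D / G) ≤ 3.1416 / 2 * (1 + 0.134) := by gcongr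
        _ ≤ 1.7825 := by norm_num
    rw [h2, mul_comm 1.7825 c]
    gcongr
    have : 0 ≤ b * Y := by positivity
    linarith
  have h5 : (Y * δ) ^ 2 ≤ (1.7825 * c) ^ 2 := by gcongr
  have h6 : Y * δ ^ 2 / 2 ≤ 1.84 * c ^ 2 := by
    have : 0 ≤ Y * δ ^ 2 := by positivity
    nlinarith
  have h7 : 1 - δ ^ 2 / 2 ≤ cos δ := one_sub_sq_div_two_le_cos
  have h8 : Y * (1 - δ ^ 2 / 2) ≤ Y * cos δ := by gcongr
  have h9 : X * cos ε ≤ 1 := mul_le_one₀ hX1 hcε (cos_le_one _)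
  have h10 : 1 - Y ≤ d ^ 2 := by nlinarith
  nlinarith [sq_nonneg d]

/-- With `G = X + Y` and `D = c² + d²` the left side is `√(G² + D) ≤ G + D/(2G)`. On the right, the
two sine terms contribute nearly `D`. The losses, from `cos b < 1` and from the factor `1 - t Y`
with `t = sin b`, are small because `hcr` bounds `t`. The balance of gain and losses is the
inequality `defect`. -/
theorem sqrt_le_of_right_quarter {X Y c d b δ ε : ℝ} (hX : 0 < X) (hY : 0 < Y) (hc : 0 ≤ c)
    (hd : 0 ≤ d) (hXc : X ^ 2 + c ^ 2 = 1) (hYd : Y ^ 2 + d ^ 2 = 1) (hb : 0 ≤ b)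
    (hδ0 : 0 ≤ δ) (hδ : δ ≤ π / 2 - b) (hε0 : 0 ≤ ε) (hε : ε ≤ π / 2 - b)
    (hδe : δ * (Y * (X + Y)) = c * (π * (1 + X * Y) - (π / 2 + b) * (Y * (X + Y))))
    (hεe : ε * (X * (X + Y)) = d * (π * (1 + X * Y) - (π / 2 - b) * (X * (X + Y))))
    (hcr : (X + Y) * sin b = X * cos ε - Y * cos δ) :
    √(2 * (1 + X * Y)) ≤ (X + Y) * cos b + Y * c * sin δ + X * d * sin ε := by
  have hπ := pi_pos
  have hX1 : X ≤ 1 := le_one_of_sq_add_sq_eq_one hXc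
  have hY1 : Y ≤ 1 := le_one_of_sq_add_sq_eq_one hYd
  obtain ⟨G, hGdef⟩ : ∃ G, G = X + Y := ⟨_, rfl⟩
  have hG : 0 < G := by rw [hGdef]; positivity
  obtain ⟨D, hDdef⟩ : ∃ D, D = c ^ 2 + d ^ 2 := ⟨_, rfl⟩
  have hD0 : 0 ≤ D := by rw [hDdef]; positivity
  have hGD : 2 * (1 + X * Y) = G ^ 2 + D := by rw [hGdef, hDdef]; linear_combination -hXc - hYd
  have hbπ : b ≤ π / 2 := by linarith
  obtain ⟨t, htdef⟩ : ∃ t, t = sin b := ⟨_, rfl⟩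
  have ht0 : 0 ≤ t := htdef ▸ sin_nonneg_of_nonneg_of_le_pi hb (by linarith)
  have hbt : 2 / π * b ≤ t := htdef ▸ mul_le_sin hb hbπ
  -- lower bounds for the sines
  have hA : c * (1 - t * Y) ≤ Y * sin δ := by
    refine le_trans ?_ (mul_sin_ge_of_mul_eq hX hY hc hX1 hY1 hδ0 (by linarith) hδe)
    gcongr
  have hB : d ≤ X * sin ε := by
    -- The roles of `X` and `Y` are exchanged and `b` changes sign, so the correction term now helps
    -- and can be dropped.
    have := mul_sin_ge_of_mul_eq (b := -b) hY hX hd hY1 hX1 hε0 (by linarith)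
      (by rw [add_comm Y X, hεe]; ring)
    refine le_trans (le_mul_of_one_le_right hd ?_) this
    have : 0 ≤ 2 / π * b * X := by positivity
    linarith
  have hcε : 0 ≤ cos ε := cos_nonneg_of_neg_pi_div_two_le_of_le (by linarith) (by linarith)
  have hD1 : D ≤ 1 := by
    have : d ≤ X := hB.trans (mul_le_of_le_one_right hX.le (sin_le_one _))
    have : d ^ 2 ≤ X ^ 2 := by gcongr
    linarith
  obtain ⟨r, hrdef⟩ : ∃ r, r = √(1 - D) := ⟨_, rfl⟩
  have hr0 : 0 ≤ r := hrdef ▸ sqrt_nonneg _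
  have hr : r ^ 2 = 1 - D := hrdef ▸ sq_sqrt (by linarith)
  have hrX : X * cos ε ≤ r := by
    rw [hrdef]
    refine le_sqrt_of_sq_le ?_
    have : d ^ 2 ≤ (X * sin ε) ^ 2 := by gcongr
    have h : (X * cos ε) ^ 2 = X ^ 2 - (X * sin ε) ^ 2 := by
      linear_combination X ^ 2 * sin_sq_add_cos_sq ε
    linarith
  have hδb : t ≤ cos δ := by
    have : cos (π / 2 - b) ≤ cos δ := cos_le_cos_of_nonneg_of_le_pi hδ0 (by linarith) hδ
    rwa [cos_pi_div_two_sub, ← htdef] at this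
  have ht : (G + Y) * t ≤ r := by
    have : Y * t ≤ Y * cos δ := by gcongr
    rw [← htdef, ← hGdef] at hcr
    linarith
  have hrXY : r ≤ X * Y := by
    rw [hrdef]
    refine sqrt_le_iff.2 ⟨by positivity, ?_⟩
    have : (X * Y) ^ 2 = (1 - c ^ 2) * (1 - d ^ 2) := by
      linear_combination Y ^ 2 * hXc + (1 - c ^ 2) * hYd
    rw [this, hDdef]
    linarith [mul_nonneg (sq_nonneg c) (sq_nonneg d)]
  have hrG : 1 + r ≤ G := by
    refine le_of_sq_le_sq ?_ hG.le
    linarith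
  have hrY : r ≤ Y := hrXY.trans (mul_le_of_le_one_left hY.le hX1)
  have hr1 : r ≤ 1 := hrY.trans hY1
  -- From `(G + Y) t ≤ r` and `G + Y ≥ 1 + 2r` with `r ≤ 1`. Hence `cos b ≥ √8/3 > 0.94`, and `1 -
  -- cos b = t² / (1 + cos b)` accounts for the constant `1.94`.
  have ht3 : t ≤ 1 / 3 := by
    have h1 : t * (1 + 2 * r) ≤ r := by
      linarith [mul_nonneg ht0 (sub_nonneg.2 hrY), mul_nonneg ht0 (sub_nonneg.2 hrG)]
    by_contra h
    linarith [mul_pos (sub_pos.2 (not_le.1 h)) (by linarith : 0 < 1 + 2 * r)]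
  have hcb0 : 0 ≤ cos b := cos_nonneg_of_neg_pi_div_two_le_of_le (by linarith) hbπ
  have hcb : 0.94 ≤ cos b := by
    have h1 : t ^ 2 ≤ (1 / 3) ^ 2 := by gcongr
    have h2 := sin_sq_add_cos_sq b
    rw [← htdef] at h2
    exact le_of_sq_le_sq (by linarith) hcb0
  have hcb' : 1 - t ^ 2 / 1.94 ≤ cos b := by
    have h := sin_sq_add_cos_sq b
    have : t ^ 2 = (1 - cos b) * (1 + cos b) := by rw [htdef]; linarith
    have h' : 1 - cos b ≤ t ^ 2 / 1.94 := by
      rw [le_div_iff₀ (by norm_num), this]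
      exact mul_le_mul_of_nonneg_left (by linarith) (by linarith [cos_le_one b])
    linarith
  have defect : D / (2 * G) + t * Y * D + t ^ 2 * G / 1.94 ≤ D := by
    rcases le_total (1 / 4) D with hD | hD
    · exact defect_le_of_large hr0 hr hD hrG hrY hY1 ht0 ht
    · have hr2 : 0.866 ≤ r := le_of_sq_le_sq (by rw [hr]; norm_num; linarith only [hD]) hr0
      have hG2 : 1.866 ≤ G := by linarith
      refine defect_le_of_small hD0 hD hG2 hY.le hY1 ht0 ?_
      rw [hGdef, htdef, hcr]
      exact mul_sub_mul_cos_le hc hX1 hGdef.symm hYd hDdef.symm hGD hD hG2 (hr2.trans hrY) hY1 hb hδ0 hδe hcε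
  rw [hGD]
  refine sqrt_sq_add_le hG hD0 ?_
  have e1 : G * (1 - t ^ 2 / 1.94) ≤ G * cos b := by gcongr
  have e2 : c * (c * (1 - t * Y)) ≤ c * (Y * sin δ) := by gcongr
  have e3 : d * d ≤ d * (X * sin ε) := by gcongr
  have e4 : t * Y * c ^ 2 ≤ t * Y * D := by
    have : 0 ≤ t * Y := by positivity
    gcongr
    rw [hDdef]; linarith [sq_nonneg d]
  have e5 : G * (t ^ 2 / 1.94) = t ^ 2 * G / 1.94 := by ring
  rw [← hGdef]
  linarith

/-- The sum `(X + Y) sin a + Y c sin δ + X d sin ε`; with `m₁, …, m₄` equal to `π` times the harmonic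
measures of the four arcs, `a = m₁ + m₃`, `δ = m₁ - m₃` and `ε = m₂ - m₄`, it determines the
curvature of a comparison graph. -/
noncomputable def slopeSum (X Y c d a δ ε : ℝ) : ℝ :=
  (X + Y) * sin a + Y * c * sin δ + X * d * sin ε

theorem slopeSum_bounds_of_nonneg {X Y c d a δ ε : ℝ} (hX : 0 < X) (hY : 0 < Y) (hc : 0 ≤ c)
    (hd : 0 ≤ d) (hXc : X ^ 2 + c ^ 2 = 1) (hYd : Y ^ 2 + d ^ 2 = 1)
    (hδ0 : 0 ≤ δ) (hε0 : 0 ≤ ε) (hδ : δ ≤ a) (hδ' : δ ≤ π - a) (hε : ε ≤ a) (hε' : ε ≤ π - a)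
    (hδe : δ * (Y * (X + Y)) = c * (π * (1 + X * Y) - a * (Y * (X + Y))))
    (hεe : ε * (X * (X + Y)) = d * (π * (1 + X * Y) - (π - a) * (X * (X + Y))))
    (hcr : Y * (cos δ - cos a) = X * (cos ε + cos a)) :
    √(2 * (1 + X * Y)) ≤ slopeSum X Y c d a δ ε ∧
      slopeSum X Y c d a δ ε ≤ 2 * √(1 + X * Y) := by
  have hπ := pi_pos
  constructor
  · rcases le_total (π / 2) a with h | h
    · have := sqrt_le_of_right_quarter (b := a - π / 2) hX hY hc hd hXc hYd (by linarith) hδ0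
        (by linarith) hε0 (by linarith) (by rw [hδe]; ring) (by rw [hεe]; ring)
        (by rw [sin_sub_pi_div_two]; linarith)
      rwa [cos_sub_pi_div_two] at this
    -- The problem is symmetric under `(X, c, δ) ↔ (Y, d, ε)`, `a ↔ π - a`.
    · have := sqrt_le_of_right_quarter (b := π / 2 - a) hY hX hd hc hYd hXc (by linarith) hε0
        (by linarith) hδ0 (by linarith) (by rw [add_comm Y X, hεe]; ring)
        (by rw [add_comm Y X, hδe]; ring) (by rw [sin_pi_div_two_sub]; linarith)
      rw [cos_pi_div_two_sub, mul_comm Y X, add_comm Y X] at this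
      unfold slopeSum
      linarith
  · have hs : ∀ θ, 0 ≤ θ → θ ≤ a → θ ≤ π - a → sin θ ≤ sin a := by
      intro θ h0 h1 h2
      rcases le_total a (π / 2) with h | h
      · exact sin_le_sin_of_le_of_le_pi_div_two (by linarith) h h1
      · rw [← sin_pi_sub a]
        exact sin_le_sin_of_le_of_le_pi_div_two (by linarith) (by linarith) h2
    have h1 := hs δ hδ0 hδ hδ'
    have h2 := hs ε hε0 hε hε'
    have hsa := sin_le_one a
    have hT : slopeSum X Y c d a δ ε ≤ X + Y + Y * c + X * d := by
      have e1 : Y * c * sin δ ≤ Y * c * 1 := by gcongr; linarith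
      have e2 : X * d * sin ε ≤ X * d * 1 := by gcongr; linarith
      have e3 : (X + Y) * sin a ≤ (X + Y) * 1 := by gcongr
      unfold slopeSum
      linarith
    refine hT.trans ?_
    have h4 : 2 * √(1 + X * Y) = √(4 * (1 + X * Y)) := by
      rw [sqrt_mul (by norm_num), show (4 : ℝ) = 2 ^ 2 by norm_num, sqrt_sq (by norm_num)]
    rw [h4]
    refine le_sqrt_of_sq_le ?_
    -- After all sines are replaced by `1`, the gap in the squared inequality is a perfect square.
    have : 4 * (1 + X * Y) - (X + Y + Y * c + X * d) ^ 2
        = (1 + X * Y - c * d - c - d) ^ 2 := by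
      linear_combination (-(1 + d) ^ 2 - Y ^ 2) * hXc - (1 + c) ^ 2 * hYd + (c ^ 2 - 1) * hYd
    nlinarith [sq_nonneg (1 + X * Y - c * d - c - d)]

/-- The factors multiplying `c` and `d` in `hδe` and `hεe` are nonnegative. So `δ` takes the sign of
`c` and `ε` that of `d`, and passing to absolute values changes neither the hypotheses nor
`slopeSum`. -/
theorem slopeSum_bounds {X Y c d a δ ε : ℝ} (hX : 0 < X) (hY : 0 < Y)
    (hXc : X ^ 2 + c ^ 2 = 1) (hYd : Y ^ 2 + d ^ 2 = 1)
    (hδ : |δ| ≤ a) (hδ' : |δ| ≤ π - a) (hε : |ε| ≤ a) (hε' : |ε| ≤ π - a)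
    (hδe : δ * (Y * (X + Y)) = c * (π * (1 + X * Y) - a * (Y * (X + Y))))
    (hεe : ε * (X * (X + Y)) = d * (π * (1 + X * Y) - (π - a) * (X * (X + Y))))
    (hcr : Y * (cos δ - cos a) = X * (cos ε + cos a)) :
    √(2 * (1 + X * Y)) ≤ slopeSum X Y c d a δ ε ∧
      slopeSum X Y c d a δ ε ≤ 2 * √(1 + X * Y) := by
  have hπ := pi_pos
  have hX1 : X ≤ 1 := le_one_of_sq_add_sq_eq_one hXc
  have hY1 : Y ≤ 1 := le_one_of_sq_add_sq_eq_one hYd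
  have ha0 : 0 ≤ a := (abs_nonneg _).trans hδ
  have ha1 : 0 ≤ π - a := (abs_nonneg _).trans hδ'
  have hp : ∀ {x y z : ℝ}, 0 < x → 0 < y → x ≤ 1 → y ≤ 1 → z ≤ π →
      0 ≤ π * (1 + x * y) - z * (x * (x + y)) := by
    intro x y z hx hy hx1 hy1 hz
    have h1 : x * (x + y) ≤ 1 + x * y := by nlinarith
    have h2 : 0 ≤ x * (x + y) := by positivity
    nlinarith [mul_nonneg hπ.le (sub_nonneg.2 h1), mul_nonneg h2 (sub_nonneg.2 hz)]
  have h1 : 0 ≤ π * (1 + X * Y) - a * (Y * (X + Y)) := by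
    have := hp hY hX hY1 hX1 (by linarith : a ≤ π); rwa [add_comm X Y, mul_comm X Y]
  have h2 := hp hX hY hX1 hY1 (by linarith : π - a ≤ π)
  have sgn : ∀ {θ e k w : ℝ}, 0 < k → 0 ≤ w → θ * k = e * w →
      |θ| * k = |e| * w ∧ |e| * sin |θ| = e * sin θ := by
    intro θ e k w hk hw h
    refine ⟨by rw [← abs_of_pos hk, ← abs_mul, h, abs_mul, abs_of_nonneg hw], ?_⟩
    rcases le_total 0 e with he | he
    · have : 0 ≤ θ := by
        by_contra hθ
        nlinarith [mul_neg_of_neg_of_pos (not_le.1 hθ) hk, mul_nonneg he hw]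
      rw [abs_of_nonneg he, abs_of_nonneg this]
    · have : θ ≤ 0 := by
        by_contra hθ
        nlinarith [mul_pos (not_le.1 hθ) hk, mul_nonneg (neg_nonneg.2 he) hw]
      rw [abs_of_nonpos he, abs_of_nonpos this, sin_neg]; ring
  obtain ⟨a1, b1⟩ := sgn (by positivity) h1 hδe
  obtain ⟨a2, b2⟩ := sgn (by positivity) h2 hεe
  have := slopeSum_bounds_of_nonneg (c := |c|) (d := |d|) hX hY (abs_nonneg _) (abs_nonneg _)
    (by rwa [sq_abs]) (by rwa [sq_abs]) (abs_nonneg _) (abs_nonneg _) hδ hδ' hε hε' a1 a2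
    (by rwa [cos_abs, cos_abs])
  have e : slopeSum X Y |c| |d| a |δ| |ε| = slopeSum X Y c d a δ ε := by
    unfold slopeSum
    linear_combination Y * b1 + X * b2
  rwa [e] at this

end TrigInequality

/-! ### The weights at the point over the center -/

section Weights

open Real

/-- With `x = q/2` and `y = q/2 - p`, `exp (2iβ)` is `(cos y + i sin x)²` divided by its modulus
`cos² y + sin² x`, and this modulus equals `1 + sin p sin (q - p)`. -/
theorem halfTilt_trig {p q : ℝ} (hp : 0 < p) (hpq : p < q) (hq : q ≤ π) :
    cos (2 * halfTilt p q) * (1 + sin p * sin (q - p)) = cos p * cos (q - p) ∧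
      sin (2 * halfTilt p q) * (1 + sin p * sin (q - p)) = sin p + sin (q - p) := by
  have hc : 0 < cos (q / 2 - p) := cos_pos_of_mem_Ioo ⟨by linarith, by linarith⟩
  obtain ⟨x, y, rfl, rfl⟩ : ∃ x y, p = x - y ∧ q = 2 * x := ⟨q / 2, q / 2 - p, by ring, by ring⟩
  have e1 : 2 * x / 2 = x := by ring
  have e2 : 2 * x / 2 - (x - y) = y := by ring
  have e3 : 2 * x - (x - y) = x + y := by ring
  rw [e2] at hc
  have hβ : halfTilt (x - y) (2 * x) = arctan (sin x / cos y) := by rw [halfTilt, e2, e1]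
  have hR : 0 < √(cos y ^ 2 + sin x ^ 2) := sqrt_pos.2 (by positivity)
  have hRsq := sq_sqrt (show 0 ≤ cos y ^ 2 + sin x ^ 2 by positivity)
  have hcos : cos (arctan (sin x / cos y)) = cos y / √(cos y ^ 2 + sin x ^ 2) := by
    rw [cos_arctan, show 1 + (sin x / cos y) ^ 2 = (cos y ^ 2 + sin x ^ 2) / cos y ^ 2 by field_simp,
      sqrt_div (by positivity), sqrt_sq hc.le]
    field_simp
  have hsin : sin (arctan (sin x / cos y)) = sin x / √(cos y ^ 2 + sin x ^ 2) := by
    rw [sin_arctan, show 1 + (sin x / cos y) ^ 2 = (cos y ^ 2 + sin x ^ 2) / cos y ^ 2 by field_simp,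
      sqrt_div (by positivity), sqrt_sq hc.le]
    field_simp
  have hN : 1 + sin (x - y) * sin (x + y) = cos y ^ 2 + sin x ^ 2 := by
    rw [sin_sub, sin_add]
    linear_combination (sin x ^ 2 - 1) * sin_sq_add_cos_sq y - sin y ^ 2 * sin_sq_add_cos_sq x
  rw [hβ, e3, hN, cos_two_mul, sin_two_mul, hcos, hsin]
  have h1 := sin_sq_add_cos_sq x
  have h2 := sin_sq_add_cos_sq y
  constructor
  · rw [div_pow, hRsq, cos_sub, cos_add]
    field_simp
    linear_combination (-cos y ^ 2) * h1 + (sin x ^ 2) * h2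
  · rw [sin_sub, sin_add]
    have : 2 * (sin x / √(cos y ^ 2 + sin x ^ 2)) * (cos y / √(cos y ^ 2 + sin x ^ 2))
        = 2 * sin x * cos y / √(cos y ^ 2 + sin x ^ 2) ^ 2 := by ring
    rw [this, hRsq]
    field_simp
    ring

theorem sin_pos_of_lt {p q : ℝ} (hp : 0 < p) (hpq : p < q) (hq : q ≤ π) :
    0 < sin p ∧ 0 < sin (q - p) :=
  ⟨sin_pos_of_pos_of_lt_pi hp (by linarith), sin_pos_of_pos_of_lt_pi (by linarith) (by linarith)⟩

theorem norm_vertex (p q : ℝ) (k : Fin 4) : ‖vertex p q k‖ = 1 := by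
  fin_cases k <;> simp only [vertex] <;> exact Complex.norm_exp_ofReal_mul_I _

/-- Triangle inequality: in a balanced sum of unit vectors no weight exceeds the sum of the others.
This gives `|δ| ≤ π - a` and `|ε| ≤ a`. -/
theorem le_pi_div_two_of_sum_eq_zero {w x y z : ℂ} {a b c d : ℝ} (ha : 0 ≤ a) (hb : 0 ≤ b)
    (hc : 0 ≤ c) (hd : 0 ≤ d) (hw : ‖w‖ = 1) (hx : ‖x‖ = 1) (hy : ‖y‖ = 1) (hz : ‖z‖ = 1)
    (hs : a + b + c + d = π) (h : a * w + b * x + c * y + d * z = 0) : a ≤ π / 2 := by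
  have h1 : (a : ℂ) * w = -(b * x + c * y + d * z) := by linear_combination h
  have h2 := congrArg norm h1
  rw [norm_neg, norm_mul, hw, Complex.norm_of_nonneg ha] at h2
  have h3 : ‖(b * x + c * y + d * z : ℂ)‖ ≤ b + c + d := by
    refine (norm_add₃_le).trans (le_of_eq ?_)
    simp [hx, hy, hz, abs_of_nonneg hb, abs_of_nonneg hc, abs_of_nonneg hd]
  linarith

/-- The real part of the balance involves only `m₁ + m₃` and `m₁ - m₃`, because `P₂` and `P₄` are
conjugate; it gives the first equation. The imaginary part then gives `m₂ - m₄`. -/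
theorem balance_equations {p q m₁ m₂ m₃ m₄ : ℝ} (hp : 0 < p) (hpq : p < q) (hq : q ≤ π)
    (hs : m₁ + m₂ + m₃ + m₄ = π)
    (h : (m₁ : ℂ) * vertex p q 0 + m₂ * vertex p q 1 + m₃ * vertex p q 2 + m₄ * vertex p q 3 = 0) :
    (m₁ - m₃) * (sin (q - p) * (sin p + sin (q - p)))
        = cos p * (π * (1 + sin p * sin (q - p))
          - (m₁ + m₃) * (sin (q - p) * (sin p + sin (q - p)))) ∧
      (m₂ - m₄) * (sin p * (sin p + sin (q - p)))
        = cos (q - p) * (π * (1 + sin p * sin (q - p))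
          - (π - (m₁ + m₃)) * (sin p * (sin p + sin (q - p)))) := by
  obtain ⟨h1, h2⟩ := halfTilt_trig hp hpq hq
  obtain ⟨hX, hY⟩ := sin_pos_of_lt hp hpq hq
  have hre := congrArg Complex.re h
  have him := congrArg Complex.im h
  simp only [vertex, Fin.isValue, Matrix.cons_val_zero, Matrix.cons_val_one, Matrix.cons_val,
    Complex.add_re, Complex.add_im, Complex.re_ofReal_mul, Complex.im_ofReal_mul,
    Complex.exp_ofReal_mul_I_re, Complex.exp_ofReal_mul_I_im, Complex.zero_re, Complex.zero_im]
    at hre him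
  rw [show p - q + 2 * halfTilt p q = 2 * halfTilt p q - (q - p) by ring,
    add_comm (q - p)] at hre him
  simp only [cos_add, cos_sub, sin_add, sin_sub, cos_neg, sin_neg] at hre him
  rw [← sin_sub, ← cos_sub] at hre him
  generalize sin (2 * halfTilt p q) = v at *
  generalize cos (2 * halfTilt p q) = u at *
  have hXc := sin_sq_add_cos_sq p
  have hYd := sin_sq_add_cos_sq (q - p)
  generalize sin p = X at *
  generalize cos p = c at *
  generalize sin (q - p) = Y at *
  generalize cos (q - p) = d at *
  have hm : m₂ + m₄ = π - (m₁ + m₃) := by linarith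
  have hre' : (m₁ + m₃) * d * u - (m₁ - m₃) * Y * v + (π - (m₁ + m₃)) * c = 0 := by
    rw [← hm]; linarith
  have him' : (m₁ + m₃) * d * v + (m₁ - m₃) * Y * u - (m₂ - m₄) * X = 0 := by linarith
  have hδ : (m₁ - m₃) * (Y * (X + Y)) = c * (π * (1 + X * Y) - (m₁ + m₃) * (Y * (X + Y))) := by
    linear_combination (-(1 + X * Y)) * hre' + (m₁ + m₃) * d * h1 - (m₁ - m₃) * Y * h2
      + (m₁ + m₃) * c * hYd
  refine ⟨hδ, ?_⟩
  have hN : 0 < 1 + X * Y := by positivity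
  refine mul_right_cancel₀ hN.ne' ?_
  linear_combination (-(1 + X * Y) * (X + Y)) * him' + (m₁ + m₃) * d * (X + Y) * h2
    + (m₁ - m₃) * Y * (X + Y) * h1 + c * d * hδ
    + d * (π * (1 + X * Y) - (m₁ + m₃) * (Y * (X + Y))) * hXc

theorem slopeSum_bounds_of_balance {p q m₁ m₂ m₃ m₄ : ℝ} (hp : 0 < p) (hpq : p < q) (hq : q ≤ π)
    (h₁ : 0 ≤ m₁) (h₂ : 0 ≤ m₂) (h₃ : 0 ≤ m₃) (h₄ : 0 ≤ m₄) (hs : m₁ + m₂ + m₃ + m₄ = π)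
    (h : (m₁ : ℂ) * vertex p q 0 + m₂ * vertex p q 1 + m₃ * vertex p q 2 + m₄ * vertex p q 3 = 0)
    (hcr : sin (q - p) * (sin m₁ * sin m₃) = sin p * (sin m₂ * sin m₄)) :
    √(2 * (1 + sin p * sin (q - p))) ≤ slopeSum (sin p) (sin (q - p)) (cos p) (cos (q - p))
        (m₁ + m₃) (m₁ - m₃) (m₂ - m₄) ∧
      slopeSum (sin p) (sin (q - p)) (cos p) (cos (q - p)) (m₁ + m₃) (m₁ - m₃) (m₂ - m₄)
        ≤ 2 * √(1 + sin p * sin (q - p)) := by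
  obtain ⟨hX, hY⟩ := sin_pos_of_lt hp hpq hq
  obtain ⟨e1, e2⟩ := balance_equations hp hpq hq hs h
  have n := norm_vertex p q
  have b1 := le_pi_div_two_of_sum_eq_zero h₁ h₂ h₃ h₄ (n 0) (n 1) (n 2) (n 3) hs h
  have b2 := le_pi_div_two_of_sum_eq_zero h₂ h₁ h₃ h₄ (n 1) (n 0) (n 2) (n 3) (by linarith)
    (by linear_combination h)
  have b3 := le_pi_div_two_of_sum_eq_zero h₃ h₁ h₂ h₄ (n 2) (n 0) (n 1) (n 3) (by linarith)
    (by linear_combination h)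
  have b4 := le_pi_div_two_of_sum_eq_zero h₄ h₁ h₂ h₃ (n 3) (n 0) (n 1) (n 2) (by linarith)
    (by linear_combination h)
  refine slopeSum_bounds hX hY (sin_sq_add_cos_sq p) (sin_sq_add_cos_sq _)
    (abs_le.2 ⟨by linarith, by linarith⟩) (abs_le.2 ⟨by linarith, by linarith⟩)
    (abs_le.2 ⟨by linarith, by linarith⟩) (abs_le.2 ⟨by linarith, by linarith⟩) e1 e2 ?_
  have hc : cos (m₁ + m₃) = -cos (m₂ + m₄) := by
    rw [← cos_pi_sub]; congr 1; linarith
  have hc' : cos (m₂ - m₄) + cos (m₁ + m₃) = 2 * (sin m₂ * sin m₄) := by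
    rw [hc, cos_sub, cos_add]; ring
  rw [hc', cos_sub, cos_add]
  linear_combination 2 * hcr

end Weights

/-! ### Harmonic measure of an arc of the unit circle -/

section HarmonicMeasure

open Complex

/-- The factor `1 - z e^{-it}`. -/
noncomputable def boundaryFactor (t : ℝ) (z : ℂ) : ℂ := 1 - z * exp (-(t * I))

/-- `π` times the harmonic measure of the arc `(a, b)`. -/
noncomputable def arcWeight (a b : ℝ) (z : ℂ) : ℝ :=
  (b - a) / 2 + (log (boundaryFactor b z)).im - (log (boundaryFactor a z)).im

theorem norm_mul_exp_neg (t : ℝ) (z : ℂ) : ‖z * exp (-(t * I))‖ = ‖z‖ := by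
  rw [norm_mul, ← neg_mul, ← ofReal_neg, norm_exp_ofReal_mul_I, mul_one]

theorem boundaryFactor_mem_slitPlane {z : ℂ} (hz : ‖z‖ < 1) (t : ℝ) :
    boundaryFactor t z ∈ slitPlane := by
  rw [boundaryFactor, sub_eq_add_neg]
  exact mem_slitPlane_of_norm_lt_one (by rwa [norm_neg, norm_mul_exp_neg])

theorem boundaryFactor_ne_zero {z : ℂ} (hz : ‖z‖ < 1) (t : ℝ) : boundaryFactor t z ≠ 0 :=
  slitPlane_ne_zero (boundaryFactor_mem_slitPlane hz t)

theorem circleMap_sub_eq (t : ℝ) (z : ℂ) :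
    circleMap 0 1 t - z = exp (t * I) * boundaryFactor t z := by
  have : exp (t * I) * exp (-(t * I)) = 1 := by rw [← exp_add]; simp
  simp only [circleMap, boundaryFactor, ofReal_one]
  linear_combination z * this

/-- The Poisson kernel is the real part of `(ζ + z)/(ζ - z) = 1 + 2 z e^{-it} / (1 - z e^{-it})`.
The factor `1 - z e^{-it}` never leaves the slit plane, so the principal logarithm gives a primitive
without branch corrections. -/
theorem hasDerivAt_log_boundaryFactor_im {z : ℂ} (hz : ‖z‖ < 1) (t : ℝ) :
    HasDerivAt (fun t : ℝ => t + 2 * (log (boundaryFactor t z)).im)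
      (poissonKernel 0 z (circleMap 0 1 t)) t := by
  have h1 : HasDerivAt (fun t : ℝ => boundaryFactor t z) (I * (z * exp (-(t * I)))) t := by
    have h0 : HasDerivAt (fun t : ℝ => -((t : ℂ) * I)) (-I) t :=
      ((ofRealCLM.hasDerivAt (x := t)).mul_const I).neg.congr_deriv (by simp)
    have := ((h0.cexp).const_mul z).const_sub 1
    exact this.congr_deriv (by ring)
  have h2 := h1.clog_real (boundaryFactor_mem_slitPlane hz t)
  have h3 := (imCLM.hasFDerivAt.comp_hasDerivAt t h2)
  refine ((hasDerivAt_id t).add (h3.const_mul 2)).congr_deriv ?_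
  have hb := boundaryFactor_ne_zero hz t
  rw [poissonKernel_eq_re_herglotzRieszKernel, Function.comp_apply, herglotzRieszKernel_def,
    sub_zero, sub_zero, circleMap_sub_eq]
  have hE : exp (t * I) * exp (-(t * I)) = 1 := by rw [← exp_add]; simp
  have hE0 := exp_ne_zero (t * I)
  have : (circleMap 0 1 t + z) / (exp (t * I) * boundaryFactor t z)
      = 1 + 2 * (-I * (I * (z * exp (-(t * I))) / boundaryFactor t z)) := by
    rw [show circleMap 0 1 t + z = exp (t * I) * (boundaryFactor t z + 2 * (z * exp (-(t * I)))) by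
      simp only [circleMap, boundaryFactor, ofReal_one]; linear_combination (-z) * hE]
    field_simp
    linear_combination (2 * z * exp (-(t * I))) * I_sq
  rw [this]
  simp

theorem harmonicMeasure_eq {z : ℂ} (hz : ‖z‖ < 1) (a b : ℝ) :
    harmonicMeasure a b z = arcWeight a b z / Real.pi := by
  have hcont : Continuous fun t => poissonKernel 0 z (circleMap 0 1 t) := by
    simp only [poissonKernel_def, sub_zero]
    refine Continuous.div (by fun_prop) (by fun_prop) fun t => ?_
    rw [circleMap_sub_eq]
    simp [boundaryFactor_ne_zero hz t]
  have := intervalIntegral.integral_eq_sub_of_hasDerivAt (a := a) (b := b)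
    (fun t _ => hasDerivAt_log_boundaryFactor_im hz t) (hcont.intervalIntegrable _ _)
  rw [harmonicMeasure, this, arcWeight]
  field_simp
  ring

theorem arcWeight_pos {z : ℂ} (hz : ‖z‖ < 1) {a b : ℝ} (hab : a < b) : 0 < arcWeight a b z := by
  have h : StrictMono (fun t : ℝ => t + 2 * (log (boundaryFactor t z)).im) := by
    refine strictMono_of_hasDerivAt_pos (fun t => hasDerivAt_log_boundaryFactor_im hz t) fun t => ?_
    rw [poissonKernel_def, sub_zero, sub_zero, circleMap_sub_eq]
    have : ‖circleMap 0 1 t‖ = 1 := by simp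
    rw [this]
    have := norm_nonneg z
    have : boundaryFactor t z ≠ 0 := boundaryFactor_ne_zero hz t
    apply div_pos
    · nlinarith
    · exact pow_pos (norm_pos_iff.2 (mul_ne_zero (exp_ne_zero _) this)) 2
  have := h hab
  simp only at this
  rw [arcWeight]
  linarith

theorem arcWeight_add_arcWeight (a b c : ℝ) (z : ℂ) :
    arcWeight a b z + arcWeight b c z = arcWeight a c z := by
  simp only [arcWeight]; ring

theorem boundaryFactor_two_pi (z : ℂ) : boundaryFactor (2 * Real.pi) z = boundaryFactor 0 z := by
  simp [boundaryFactor, exp_neg]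

theorem arcWeight_circle (z : ℂ) : arcWeight 0 (2 * Real.pi) z = Real.pi := by
  rw [arcWeight, boundaryFactor_two_pi]; ring

/-- An arc weight is the argument of an explicit product. Imaginary and real parts therefore give
its sine and cosine as polynomials in `z` and `conj z`, up to the distances from `z` to the two end
points. -/
theorem norm_mul_exp_arcWeight (z : ℂ) (a b : ℝ) :
    (‖boundaryFactor a z‖ * ‖boundaryFactor b z‖ : ℂ) * exp (arcWeight a b z * I)
      = exp (((b - a) / 2 : ℝ) * I)
        * (boundaryFactor b z * (starRingEnd ℂ) (boundaryFactor a z)) := by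
  have key : ∀ t, (‖boundaryFactor t z‖ : ℂ) * exp ((log (boundaryFactor t z)).im * I)
      = boundaryFactor t z := by
    intro t
    rw [log_im]
    exact norm_mul_exp_arg_mul_I _
  have key' : ∀ t, (‖boundaryFactor t z‖ : ℂ) * exp (-(log (boundaryFactor t z)).im * I)
      = (starRingEnd ℂ) (boundaryFactor t z) := by
    intro t
    conv_rhs => rw [← key t]
    rw [map_mul, conj_ofReal, ← exp_conj, map_mul, conj_ofReal, conj_I]
    ring_nf
  rw [show (arcWeight a b z : ℂ) * I = (((b - a) / 2 : ℝ) : ℂ) * I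
    + (log (boundaryFactor b z)).im * I + -(log (boundaryFactor a z)).im * I by
      simp only [arcWeight]; push_cast; ring, exp_add, exp_add]
  linear_combination exp (((b - a) / 2 : ℝ) * I)
    * (exp (-(log (boundaryFactor a z)).im * I) * ‖boundaryFactor a z‖ * key b
      + boundaryFactor b z * key' a)

theorem exp_mul_boundaryFactor_mul_conj (z : ℂ) (a b : ℝ) :
    exp (((b - a) / 2 : ℝ) * I) * (boundaryFactor b z * (starRingEnd ℂ) (boundaryFactor a z))
      = exp (((b - a) / 2 : ℝ) * I) + normSq z * exp (-((b - a) / 2 : ℝ) * I)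
        - 2 * (z * exp (-((a + b) / 2 : ℝ) * I)).re := by
  have hre : ∀ w : ℂ, (2 * (w.re : ℂ)) = w + (starRingEnd ℂ) w := fun w => by
    rw [add_conj]; push_cast; ring
  rw [hre, normSq_eq_conj_mul_self]
  simp only [boundaryFactor, map_sub, map_mul, map_one, ← exp_conj, map_neg, conj_ofReal, conj_I]
  have e1 : exp (((b - a) / 2 : ℝ) * I) * exp (-(b * I)) = exp (-((a + b) / 2 : ℝ) * I) := by
    rw [← exp_add]; congr 1; push_cast; ring
  have e2 : exp (((b - a) / 2 : ℝ) * I) * exp (-(a * -I)) = exp (-((a + b) / 2 : ℝ) * -I) := by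
    rw [← exp_add]; congr 1; push_cast; ring
  have e3 : exp (((b - a) / 2 : ℝ) * I) * exp (-(b * I)) * exp (-(a * -I))
      = exp (-((b - a) / 2 : ℝ) * I) := by
    rw [← exp_add, ← exp_add]; congr 1; push_cast; ring
  linear_combination (-z) * e1 - (starRingEnd ℂ) z * e2 + z * (starRingEnd ℂ) z * e3

theorem norm_mul_sin_arcWeight (z : ℂ) (a b : ℝ) :
    ‖boundaryFactor a z‖ * ‖boundaryFactor b z‖ * Real.sin (arcWeight a b z)
      = Real.sin ((b - a) / 2) * (1 - ‖z‖ ^ 2) := by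
  have := congrArg im ((norm_mul_exp_arcWeight z a b).trans
    (exp_mul_boundaryFactor_mul_conj z a b))
  rw [← ofReal_mul, im_ofReal_mul, exp_ofReal_mul_I_im, sub_im, add_im, exp_ofReal_mul_I_im,
    im_ofReal_mul, ← ofReal_neg, exp_ofReal_mul_I_im, Real.sin_neg, normSq_eq_norm_sq] at this
  rw [this]
  simp
  ring

theorem norm_mul_cos_arcWeight (z : ℂ) (a b : ℝ) :
    ‖boundaryFactor a z‖ * ‖boundaryFactor b z‖ * Real.cos (arcWeight a b z)
      = Real.cos ((b - a) / 2) * (1 + ‖z‖ ^ 2) - 2 * (z * exp (-((a + b) / 2 : ℝ) * I)).re := by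
  have := congrArg re ((norm_mul_exp_arcWeight z a b).trans
    (exp_mul_boundaryFactor_mul_conj z a b))
  rw [← ofReal_mul, re_ofReal_mul, exp_ofReal_mul_I_re, sub_re, add_re, exp_ofReal_mul_I_re,
    re_ofReal_mul, ← ofReal_neg, exp_ofReal_mul_I_re, Real.cos_neg, normSq_eq_norm_sq] at this
  rw [this]
  simp
  ring

theorem hasFDerivAt_log_boundaryFactor_im {z : ℂ} (hz : ‖z‖ < 1) (t : ℝ) :
    ∃ L : ℂ →L[ℝ] ℝ, HasFDerivAt (fun z => (log (boundaryFactor t z)).im) L z ∧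
      ∀ v, L v = ((z - exp (t * I))⁻¹ * v).im := by
  have h1 : HasDerivAt (fun z : ℂ => boundaryFactor t z) (-exp (-(t * I))) z :=
    (((hasDerivAt_id z).mul_const (exp (-(t * I)))).const_sub 1).congr_deriv (by simp)
  have h2 := (h1.clog (boundaryFactor_mem_slitPlane hz t)).hasFDerivAt.restrictScalars ℝ
  refine ⟨_, imCLM.hasFDerivAt.comp z h2, fun v => ?_⟩
  have hb := boundaryFactor_ne_zero hz t
  have hc := circleMap_sub_eq t z
  have hE : exp (t * I) * exp (-(t * I)) = 1 := by rw [← exp_add]; simp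
  have : -exp (-(t * I)) / boundaryFactor t z = (z - exp (t * I))⁻¹ := by
    have h : z - exp (t * I) = -(exp (t * I) * boundaryFactor t z) := by
      rw [← hc]; simp [circleMap]
    rw [h, div_eq_iff hb, inv_neg, mul_inv, neg_mul, mul_assoc, inv_mul_cancel₀ hb, mul_one,
      neg_inj]
    exact eq_inv_of_mul_eq_one_right hE
  rw [← this, mul_comm _ v]
  rfl

theorem hasFDerivAt_harmonicMeasure {z : ℂ} (hz : ‖z‖ < 1) (a b : ℝ) :
    ∃ L : ℂ →L[ℝ] ℝ, HasFDerivAt (harmonicMeasure a b) L z ∧ ∀ v, L v =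
      (((z - exp (b * I))⁻¹ - (z - exp (a * I))⁻¹) * v).im / Real.pi := by
  obtain ⟨La, ha, ha'⟩ := hasFDerivAt_log_boundaryFactor_im hz a
  obtain ⟨Lb, hb, hb'⟩ := hasFDerivAt_log_boundaryFactor_im hz b
  have h := (((hb.const_add ((b - a) / 2)).sub ha).mul_const (Real.pi⁻¹))
  refine ⟨_, h.congr_of_eventuallyEq ?_, fun v => ?_⟩
  · filter_upwards [(isOpen_lt continuous_norm continuous_const).mem_nhds hz] with w hw
    rw [harmonicMeasure_eq hw, arcWeight, div_eq_mul_inv]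
    rfl
  · simp only [smul_apply, sub_apply, ha', hb', smul_eq_mul,
      sub_mul, sub_im]
    ring

end HarmonicMeasure

/-! ### The derivative of the horizontal projection -/

section Derivative

open Complex

/-- `∑ c_k ((z - ζ_k)⁻¹ - (z - ζ_{k-1})⁻¹)` for the boundary points `1, E², -1, -E²`. -/
noncomputable def stepSum (c : Fin 4 → ℂ) (E z : ℂ) : ℂ :=
  ((z - E ^ 2)⁻¹ - (z - 1)⁻¹) * c 0 + ((z + 1)⁻¹ - (z - E ^ 2)⁻¹) * c 1
    + ((z + E ^ 2)⁻¹ - (z + 1)⁻¹) * c 2 + ((z - 1)⁻¹ - (z + E ^ 2)⁻¹) * c 3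

theorem ne_of_norm_lt_one {z w : ℂ} (hz : ‖z‖ < 1) (hw : ‖w‖ = 1) : z - w ≠ 0 := by
  intro h
  rw [sub_eq_zero.1 h, hw] at hz
  exact lt_irrefl _ hz

theorem denominator_ne_zero {E z : ℂ} (hE : ‖E‖ = 1) (hz : ‖z‖ < 1) :
    (z ^ 2 - 1) * (z ^ 2 - E ^ 4) ≠ 0 := by
  have hz2 : ‖z ^ 2‖ < 1 := by rw [norm_pow]; exact pow_lt_one₀ (norm_nonneg z) hz two_ne_zero
  exact mul_ne_zero (ne_of_norm_lt_one hz2 (by simp)) (ne_of_norm_lt_one hz2 (by simp [hE]))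

theorem stepSum_eq {c : Fin 4 → ℂ} {E z : ℂ} (hE : ‖E‖ = 1) (hz : ‖z‖ < 1) :
    stepSum c E z = (((c 0 + c 3 - c 1 - c 2) * E ^ 2 + (c 2 + c 3 - c 0 - c 1)) * z ^ 2
      + (c 0 + c 2 - c 1 - c 3) * (E ^ 4 - 1) * z
      - ((c 0 + c 3 - c 1 - c 2) * E ^ 2 + (c 2 + c 3 - c 0 - c 1) * E ^ 4))
      / ((z ^ 2 - 1) * (z ^ 2 - E ^ 4)) := by
  have h1 : z - 1 ≠ 0 := ne_of_norm_lt_one hz (by simp)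
  have h2 : z + 1 ≠ 0 := by
    have : z - (-1) ≠ 0 := ne_of_norm_lt_one hz (by simp)
    rwa [sub_neg_eq_add] at this
  have h3 : z - E ^ 2 ≠ 0 := ne_of_norm_lt_one hz (by simp [hE])
  have h4 : z + E ^ 2 ≠ 0 := by
    have : z - (-E ^ 2) ≠ 0 := ne_of_norm_lt_one hz (by simp [hE])
    rwa [sub_neg_eq_add] at this
  have e : (z ^ 2 - 1) * (z ^ 2 - E ^ 4) = (z - 1) * (z + 1) * (z - E ^ 2) * (z + E ^ 2) := by ring
  rw [e, stepSum]
  field_simp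
  ring

theorem stepSum_eq_sq {c : Fin 4 → ℂ} {E z l m : ℂ} (hE : ‖E‖ = 1) (hz : ‖z‖ < 1)
    (hl : l ^ 2 = (c 0 + c 3 - c 1 - c 2) * E ^ 2 + (c 2 + c 3 - c 0 - c 1))
    (hm : m ^ 2 = -((c 0 + c 3 - c 1 - c 2) * E ^ 2 + (c 2 + c 3 - c 0 - c 1) * E ^ 4))
    (hlm : 2 * (l * m) = (c 0 + c 2 - c 1 - c 3) * (E ^ 4 - 1)) :
    stepSum c E z = (l * z + m) ^ 2 / ((z ^ 2 - 1) * (z ^ 2 - E ^ 4)) := by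
  rw [stepSum_eq hE hz]
  congr 1
  linear_combination (-z ^ 2) * hl - z * hlm - hm

/-- Conjugating the values turns the numerator into `-E⁴` times the reciprocal polynomial with
conjugate coefficients, so it is a square together with the original one. -/
theorem stepSum_conj_eq_sq {c : Fin 4 → ℂ} {E z l m : ℂ} (hE : ‖E‖ = 1) (hz : ‖z‖ < 1)
    (hl : l ^ 2 = (c 0 + c 3 - c 1 - c 2) * E ^ 2 + (c 2 + c 3 - c 0 - c 1))
    (hm : m ^ 2 = -((c 0 + c 3 - c 1 - c 2) * E ^ 2 + (c 2 + c 3 - c 0 - c 1) * E ^ 4))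
    (hlm : 2 * (l * m) = (c 0 + c 2 - c 1 - c 3) * (E ^ 4 - 1)) :
    stepSum (fun k => (starRingEnd ℂ) (c k)) E z
      = -E ^ 4 * ((starRingEnd ℂ) l + (starRingEnd ℂ) m * z) ^ 2
        / ((z ^ 2 - 1) * (z ^ 2 - E ^ 4)) := by
  rw [stepSum_eq hE hz]
  congr 1
  have hEE : E * (starRingEnd ℂ) E = 1 := by rw [mul_conj, normSq_eq_norm_sq, hE]; simp
  have hl' := congrArg (starRingEnd ℂ) hl
  have hm' := congrArg (starRingEnd ℂ) hm
  have hlm' := congrArg (starRingEnd ℂ) hlm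
  simp only [map_add, map_sub, map_mul, map_pow, map_neg, map_one, map_ofNat] at hl' hm' hlm'
  generalize (starRingEnd ℂ) E = F at *
  have h2 : E ^ 2 * F ^ 2 = 1 := by rw [← mul_pow, hEE, one_pow]
  have h4 : E ^ 4 * F ^ 4 = 1 := by rw [← mul_pow, hEE, one_pow]
  have e1 : E ^ 4 * F ^ 2 = E ^ 2 := by linear_combination E ^ 2 * h2
  have a1 : E ^ 4 * (starRingEnd ℂ) m ^ 2 = -(((starRingEnd ℂ) (c 0) + (starRingEnd ℂ) (c 3)
      - (starRingEnd ℂ) (c 1) - (starRingEnd ℂ) (c 2)) * E ^ 2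
      + ((starRingEnd ℂ) (c 2) + (starRingEnd ℂ) (c 3)
      - (starRingEnd ℂ) (c 0) - (starRingEnd ℂ) (c 1))) := by
    rw [hm', ← e1]; linear_combination (-((starRingEnd ℂ) (c 2) + (starRingEnd ℂ) (c 3)
      - (starRingEnd ℂ) (c 0) - (starRingEnd ℂ) (c 1))) * h4
  have a2 : E ^ 4 * (starRingEnd ℂ) l ^ 2 = ((starRingEnd ℂ) (c 0) + (starRingEnd ℂ) (c 3)
      - (starRingEnd ℂ) (c 1) - (starRingEnd ℂ) (c 2)) * E ^ 2
      + ((starRingEnd ℂ) (c 2) + (starRingEnd ℂ) (c 3)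
      - (starRingEnd ℂ) (c 0) - (starRingEnd ℂ) (c 1)) * E ^ 4 := by
    rw [hl', ← e1]; ring
  have a3 : E ^ 4 * (2 * ((starRingEnd ℂ) l * (starRingEnd ℂ) m))
      = -(((starRingEnd ℂ) (c 0) + (starRingEnd ℂ) (c 2)
      - (starRingEnd ℂ) (c 1) - (starRingEnd ℂ) (c 3)) * (E ^ 4 - 1)) := by
    rw [hlm']; linear_combination ((starRingEnd ℂ) (c 0) + (starRingEnd ℂ) (c 2)
      - (starRingEnd ℂ) (c 1) - (starRingEnd ℂ) (c 3)) * h4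
  linear_combination z ^ 2 * a1 + a2 + z * a3

/-- Splits a real multiple of `c` into a part linear in `x` and a part antilinear in `x`, which
separates `f_z` from `f_z̄`. -/
theorem im_smul_eq (x c : ℂ) :
    (x.im / Real.pi) • c = (2 * Real.pi * I)⁻¹ * (x * c)
      + (starRingEnd ℂ) ((2 * Real.pi * I)⁻¹ * (x * (starRingEnd ℂ) c)) := by
  have hπ : (Real.pi : ℂ) ≠ 0 := ofReal_ne_zero.2 Real.pi_ne_zero
  have h : x - (starRingEnd ℂ) x = 2 * x.im * I := by
    rw [sub_conj]; push_cast; ring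
  rw [real_smul]
  simp only [map_mul, map_inv₀, conj_I, conj_ofReal, map_ofNat, conj_conj]
  push_cast
  field_simp
  linear_combination (-c) * h

theorem hasFDerivAt_horizontalProjection {p q : ℝ} {z : ℂ} (hz : ‖z‖ < 1) :
    ∃ L : ℂ →L[ℝ] ℂ, HasFDerivAt (horizontalProjection p q) L z ∧ ∀ v, L v =
      (2 * Real.pi * I)⁻¹ * stepSum (vertex p q) (exp ((arcAngle p q / 2 : ℝ) * I)) z * v
      + (starRingEnd ℂ) ((2 * Real.pi * I)⁻¹ * stepSum (fun k => (starRingEnd ℂ) (vertex p q k))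
          (exp ((arcAngle p q / 2 : ℝ) * I)) z * v) := by
  set α := arcAngle p q with hα
  obtain ⟨L0, d0, e0⟩ := hasFDerivAt_harmonicMeasure hz 0 α
  obtain ⟨L1, d1, e1⟩ := hasFDerivAt_harmonicMeasure hz α Real.pi
  obtain ⟨L2, d2, e2⟩ := hasFDerivAt_harmonicMeasure hz Real.pi (Real.pi + α)
  obtain ⟨L3, d3, e3⟩ := hasFDerivAt_harmonicMeasure hz (Real.pi + α) (2 * Real.pi)
  have d := (((d0.smul_const (vertex p q 0)).add (d1.smul_const (vertex p q 1))).add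
    (d2.smul_const (vertex p q 2))).add (d3.smul_const (vertex p q 3))
  refine ⟨_, d, fun v => ?_⟩
  have hE : exp (α * I) = exp ((α / 2 : ℝ) * I) ^ 2 := by
    rw [← exp_nat_mul]; congr 1; push_cast; ring
  have hE' : exp ((Real.pi + α : ℝ) * I) = -exp ((α / 2 : ℝ) * I) ^ 2 := by
    rw [← hE, ofReal_add, add_mul, exp_add, exp_pi_mul_I]; ring
  have h0 : exp ((0 : ℝ) * I) = 1 := by simp
  have h2 : exp ((2 * Real.pi : ℝ) * I) = 1 := by push_cast; exact exp_two_pi_mul_I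
  rw [h0, hE] at e0
  rw [hE, exp_pi_mul_I, sub_neg_eq_add] at e1
  rw [hE', exp_pi_mul_I, sub_neg_eq_add, sub_neg_eq_add] at e2
  rw [hE', h2, sub_neg_eq_add] at e3
  simp only [add_apply, ContinuousLinearMap.smulRight_apply, e0, e1, e2, e3, im_smul_eq, stepSum]
  simp only [map_add, map_mul, map_sub, map_inv₀, map_pow, conj_conj, map_one]
  ring

end Derivative

/-! ### The square root of the derivative -/

section SquareRoot

open Complex

theorem norm_sq_add_norm_sq_eq (l m z : ℂ) :
    ‖l * z + m‖ ^ 2 + ‖(starRingEnd ℂ) l + (starRingEnd ℂ) m * z‖ ^ 2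
      = (‖l‖ ^ 2 + ‖m‖ ^ 2) * (1 + ‖z‖ ^ 2) + 4 * (l * (starRingEnd ℂ) m * z).re := by
  simp only [← normSq_eq_norm_sq, normSq_apply, add_re, add_im, mul_re, mul_im, conj_re, conj_im]
  ring

/-- Here `w = exp (2iβ)`, `s = sin (α/2)`, `k = cos (α/2)`. The prescribed values of `l²`, `m²` and
`l m` are compatible exactly when `hquad` holds, and `hquad` follows from the quadratic equation `N
w² - 2 c d w + N = 0` for `w`. With `R = √(XY)` one finds `√N |l|² = 4R(1 - R)` and `√N |m|² = 4R(1
+ R)`. -/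
theorem exists_sqrt_data {X Y c d s k : ℝ} {w E : ℂ} (hX : 0 < X) (hY : 0 < Y)
    (hXc : X ^ 2 + c ^ 2 = 1) (hYd : Y ^ 2 + d ^ 2 = 1) (hs : 0 < s) (hk : 0 < k)
    (hsk : s ^ 2 + k ^ 2 = 1) (hXs : X = (X + Y) * s ^ 2) (hYk : Y = (X + Y) * k ^ 2)
    (hw : w * (1 + X * Y) = c * d + (X + Y) * I) (hE : E = k + s * I) :
    ∃ l m : ℂ,
      l ^ 2 = 4 * I * E * ((X + Y) * s * k) * (s + I * k * w) ∧
      m ^ 2 = -4 * I * E ^ 3 * ((X + Y) * s * k) * (s - I * k * w) ∧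
      l * m = 4 * I * E ^ 2 * (s * k) * (d * w - c) ∧
      ‖l‖ < ‖m‖ ∧ ∀ z : ℂ,
        √(1 + X * Y) / 4 * (‖l * z + m‖ ^ 2 + ‖(starRingEnd ℂ) l + (starRingEnd ℂ) m * z‖ ^ 2)
          = 2 * ((X + Y) * s * k) * (1 + ‖z‖ ^ 2)
            + 4 * (Y * c * s * (z * (starRingEnd ℂ) E).re
              + X * d * k * (z * (starRingEnd ℂ) E).im) := by
  have hX1 : X ≤ 1 := le_one_of_sq_add_sq_eq_one hXc
  have hY1 : Y ≤ 1 := le_one_of_sq_add_sq_eq_one hYd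
  obtain ⟨G, hG⟩ : ∃ G, G = X + Y := ⟨_, rfl⟩
  have hG0 : 0 < G := by rw [hG]; positivity
  rw [← hG] at hXs hYk
  obtain ⟨R, hR⟩ : ∃ R, R = G * s * k := ⟨_, rfl⟩
  have hR0 : 0 < R := by rw [hR]; positivity
  have hRXY : R ^ 2 = X * Y := by rw [hR, hXs, hYk]; ring
  have hR1 : R ≤ 1 := by
    refine le_of_sq_le_sq ?_ zero_le_one
    rw [hRXY, one_pow]; exact mul_le_one₀ hX1 hY.le hY1
  obtain ⟨N, hN⟩ : ∃ N, N = 1 + X * Y := ⟨_, rfl⟩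
  have hN0 : 0 < N := by rw [hN]; positivity
  have hNR : N = 1 + R ^ 2 := by rw [hRXY, hN]
  have hN2 : N ^ 2 = (c * d) ^ 2 + G ^ 2 := by
    rw [hN, hG]; linear_combination (-d ^ 2) * hXc + (X ^ 2 - 1) * hYd
  have hwre : w.re * N = c * d := by
    have := congrArg re hw
    simpa [hN] using this
  have hwim : w.im * N = G := by
    have := congrArg im hw
    simpa [hN, hG] using this
  have hw1 : w.re ^ 2 + w.im ^ 2 = 1 := by
    have : (w.re ^ 2 + w.im ^ 2) * N ^ 2 = 1 * N ^ 2 := by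
      rw [one_mul]; nth_rw 2 [hN2]; rw [← hwre, ← hwim]; ring
    exact mul_right_cancel₀ (by positivity) this
  have hE1 : ‖E‖ = 1 := by
    rw [← sq_eq_sq₀ (norm_nonneg _) zero_le_one, ← normSq_eq_norm_sq, hE, normSq_apply]
    simp; linarith
  have hn := Real.sq_sqrt hN0.le
  have hn0 : 0 < √N := Real.sqrt_pos.2 hN0
  rw [← hN, ← hG]
  generalize √N = n at *
  have n2 : ‖(s - I * k * w : ℂ)‖ * n = 1 + R := by
    refine (sq_eq_sq₀ (by positivity) (by positivity)).1 ?_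
    rw [mul_pow, hn, ← normSq_eq_norm_sq, normSq_apply]
    simp
    linear_combination (2 * s * k) * hwim + N * k ^ 2 * hw1 + N * hsk - 2 * hR + hNR
  have n1 : ‖(s + I * k * w : ℂ)‖ * n = 1 - R := by
    refine (sq_eq_sq₀ (by positivity) (by linarith)).1 ?_
    rw [mul_pow, hn, ← normSq_eq_norm_sq, normSq_apply]
    simp
    linear_combination (-2 * s * k) * hwim + N * k ^ 2 * hw1 + N * hsk + 2 * hR + hNR
  obtain ⟨m, hm⟩ := IsAlgClosed.exists_pow_nat_eq
    (-4 * I * E ^ 3 * R * (s - I * k * w)) two_pos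
  have m2 : ‖m‖ ^ 2 * n = 4 * R * (1 + R) := by
    rw [← norm_pow, hm, ← n2]
    simp [hE1, abs_of_pos hR0]; ring
  have hm0 : m ≠ 0 := by
    rintro rfl
    have : 0 < R * (1 + R) := by positivity
    simp at m2; rcases m2 with h | h <;> linarith
  have hGsk : (G * s * k : ℂ) = R := by rw [hR]; push_cast; ring
  have hNC : (N : ℂ) = 1 + X * Y := by rw [hN]; push_cast; ring
  have hGC : (G : ℂ) = X + Y := by rw [hG]; push_cast; ring
  have hN0C : (N : ℂ) ≠ 0 := ofReal_ne_zero.2 hN0.ne'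
  have hXcC : (X : ℂ) ^ 2 + c ^ 2 = 1 := by exact_mod_cast congrArg ofReal hXc
  have hYdC : (Y : ℂ) ^ 2 + d ^ 2 = 1 := by exact_mod_cast congrArg ofReal hYd
  have hXsC : (X : ℂ) = G * s ^ 2 := by exact_mod_cast congrArg ofReal hXs
  have hYkC : (Y : ℂ) = G * k ^ 2 := by exact_mod_cast congrArg ofReal hYk
  rw [← hNC, ← hGC] at hw
  have hquad : -(d * w - c) ^ 2 = G ^ 2 * (s ^ 2 + k ^ 2 * w ^ 2) := by
    have hN2C : (N : ℂ) ^ 2 = (c * d) ^ 2 + G ^ 2 := by exact_mod_cast congrArg ofReal hN2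
    have hq : N * w ^ 2 - 2 * c * d * w + N = 0 := by
      refine (mul_eq_zero_iff_left hN0C).1 ?_
      linear_combination (w * N - c * d + G * I) * hw + hN2C + G ^ 2 * I_sq
    rw [hNC] at hq
    have hGY : (G : ℂ) ^ 2 * k ^ 2 = X * Y + Y ^ 2 := by
      linear_combination (-G : ℂ) * hYkC + Y * hGC
    have hGX : (G : ℂ) ^ 2 * s ^ 2 = X * Y + X ^ 2 := by
      linear_combination (-G : ℂ) * hXsC + X * hGC
    linear_combination -hq - w ^ 2 * (hYdC + hGY) - hXcC - hGX
  have hconj : N * (d * w - c) * (s + I * k * (starRingEnd ℂ) w)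
      = -(G * (1 + R)) * (k * c - I * s * d) := by
    have hwb : (starRingEnd ℂ) w * N = c * d - G * I := by
      have := congrArg (starRingEnd ℂ) hw
      simp only [map_add, map_mul, conj_ofReal, conj_I] at this
      rw [this]; ring
    have hwwb : w * (starRingEnd ℂ) w = 1 := by
      rw [mul_conj, normSq_apply]; exact_mod_cast (by linarith : w.re * w.re + w.im * w.im = 1)
    have hdN : (d : ℂ) ^ 2 - N = -(Y * G) := by
      linear_combination hYdC - hNC + Y * hGC
    have hcN : (N : ℂ) - c ^ 2 = X * G := by
      linear_combination hNC - hXcC - X * hGC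
    have hsY : (s : ℂ) * Y = R * k := by
      linear_combination s * hYkC + k * hGsk
    have hkX : (k : ℂ) * X = R * s := by
      linear_combination k * hXsC + s * hGsk
    linear_combination d * s * hw + I * k * d * N * hwwb - I * k * c * hwb + s * c * hdN
      + I * k * d * hcN - c * G * hsY + I * d * G * hkX + k * c * G * I_sq
  have hlm : 4 * I * E ^ 2 * (s * k) * (d * w - c) / m * m = 4 * I * E ^ 2 * (s * k) * (d * w - c) :=
    div_mul_cancel₀ _ hm0
  -- Dividing the prescribed product by `m`, instead of extracting a second root, fixes the sign of
  -- `l`.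
  obtain ⟨l, hl⟩ : ∃ l, l = 4 * I * E ^ 2 * (s * k) * (d * w - c) / m := ⟨_, rfl⟩
  rw [← hl] at hlm
  have hl2 : l ^ 2 = 4 * I * E * R * (s + I * k * w) := by
    refine mul_right_cancel₀ (pow_ne_zero 2 hm0) ?_
    rw [← mul_pow, hlm]
    rw [hm, ← hGsk]
    linear_combination (16 * E ^ 4 * s ^ 2 * k ^ 2) * hquad
      + 16 * E ^ 4 * s ^ 2 * k ^ 2 * ((d * w - c) ^ 2 + G ^ 2 * s ^ 2
        - k ^ 2 * w ^ 2 * G ^ 2 * (I ^ 2 - 1)) * I_sq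
  have l2 : ‖l‖ ^ 2 * n = 4 * R * (1 - R) := by
    rw [← norm_pow, hl2, ← n1]
    simp [hE1, abs_of_pos hR0]; ring
  -- Obtained from `|m|² · l conj m = (l m)(conj m)²`, whose right side is free of square roots.
  have hlmc : n * (l * (starRingEnd ℂ) m) = 4 * R * (starRingEnd ℂ) E * (k * c - I * s * d) := by
    have hEE : E * (starRingEnd ℂ) E = 1 := by rw [mul_conj, normSq_eq_norm_sq, hE1]; simp
    have hmm : n * (m * (starRingEnd ℂ) m) = 4 * R * (1 + R) := by
      rw [mul_conj, normSq_eq_norm_sq]; exact_mod_cast (by linarith : n * ‖m‖ ^ 2 = 4 * R * (1 + R))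
    have hmb : (starRingEnd ℂ) m ^ 2
        = 4 * I * (starRingEnd ℂ) E ^ 3 * R * (s + I * k * (starRingEnd ℂ) w) := by
      have := congrArg (starRingEnd ℂ) hm
      simp only [map_sub, map_mul, map_neg, map_pow, map_ofNat, conj_ofReal, conj_I] at this
      rw [this]; ring
    have hnC : (n : ℂ) ^ 2 = N := by exact_mod_cast congrArg ofReal hn
    have h0 : (4 * R * (1 + R) : ℂ) ≠ 0 := by
      exact_mod_cast (by positivity : 4 * R * (1 + R) ≠ 0)
    refine mul_right_cancel₀ h0 ?_
    calc n * (l * (starRingEnd ℂ) m) * (4 * R * (1 + R))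
        = N * (l * m) * (starRingEnd ℂ) m ^ 2 := by rw [← hmm, ← hnC]; ring
      _ = 16 * I ^ 2 * (E * (starRingEnd ℂ) E) ^ 2 * (starRingEnd ℂ) E * R * (s * k)
          * (N * (d * w - c) * (s + I * k * (starRingEnd ℂ) w)) := by rw [hlm, hmb]; ring
      _ = 4 * R * (starRingEnd ℂ) E * (k * c - I * s * d) * (4 * R * (1 + R)) := by
        rw [hconj, hEE, I_sq]
        linear_combination (16 * (starRingEnd ℂ) E * R * (1 + R) * (k * c - I * s * d)) * hGsk
  rw [← hGC, hGsk]
  refine ⟨l, m, hl2, hm, hlm, ?_, fun z => ?_⟩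
  · refine lt_of_pow_lt_pow_left₀ 2 (norm_nonneg _) ?_
    refine lt_of_mul_lt_mul_right ?_ hn0.le
    rw [l2, m2]
    nlinarith
  · rw [norm_sq_add_norm_sq_eq]
    have h1 : n * (l * (starRingEnd ℂ) m * z).re
        = 4 * (Y * c * s * (z * (starRingEnd ℂ) E).re + X * d * k * (z * (starRingEnd ℂ) E).im) := by
      rw [← re_ofReal_mul, ← mul_assoc, hlmc, show (4 * R * (starRingEnd ℂ) E * (k * c - I * s * d) * z : ℂ)
        = (4 * R : ℝ) * ((z * (starRingEnd ℂ) E) * (k * c - I * s * d)) by push_cast; ring,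
        re_ofReal_mul, mul_re, hXs, hYk, hR]
      simp
      ring
    rw [← hR]
    linear_combination (1 + ‖z‖ ^ 2) / 4 * (l2 + m2) + h1

end SquareRoot

/-! ### Curvature of a graph in terms of its Gauss map -/

section Curvature

open Complex

/-- The complex gradient `u_x - i u_y`. -/
noncomputable def complexGradient (u : ℂ → ℝ) (z : ℂ) : ℂ := dx u z - I * dy u z

theorem real_clm_eq_re (L : ℂ →L[ℝ] ℝ) (v : ℂ) : L v = ((L 1 - I * L I) * v).re := by
  have : v = v.re • (1 : ℂ) + v.im • I := by simp
  conv_lhs => rw [this, map_add, map_smul, map_smul]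
  simp
  ring

theorem complexGradient_comp {u : ℂ → ℝ} {f : ℂ → ℂ} {z h g : ℂ} {L : ℂ →L[ℝ] ℂ}
    (hu : DifferentiableAt ℝ u (f z)) (hf : HasFDerivAt f L z)
    (hL : ∀ v, L v = h * v + (starRingEnd ℂ) (g * v)) :
    complexGradient (fun w => u (f w)) z
      = complexGradient u (f z) * h + (starRingEnd ℂ) (complexGradient u (f z)) * g := by
  have hd : HasFDerivAt (fun w => u (f w)) ((fderiv ℝ u (f z)).comp L) z :=
    hu.hasFDerivAt.comp z hf
  simp only [complexGradient, dx, dy, hd.fderiv, ContinuousLinearMap.comp_apply]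
  rw [real_clm_eq_re _ (L 1), real_clm_eq_re _ (L I), hL, hL]
  apply Complex.ext
  · simp
    ring
  · simp
    ring

/-- Conformality means that the squares of the `∂_z`-derivatives of the three coordinates sum to
zero; the two horizontal ones contribute `h g`. -/
theorem sq_eq_of_isothermal {f : ℂ → ℂ} {F : ℂ → ℝ} {z h g : ℂ} {L : ℂ →L[ℝ] ℂ}
    (hf : HasFDerivAt f L z) (hL : ∀ v, L v = h * v + (starRingEnd ℂ) (g * v))
    (hiso : IsIsothermalAt f F z) : complexGradient F z ^ 2 = -4 * (h * g) := by
  obtain ⟨h1, h2⟩ := hiso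
  simp only [dx, dy, hf.fderiv, hL, ← normSq_eq_norm_sq, normSq_apply, Complex.inner] at h1 h2
  simp only [complexGradient, dx, dy]
  generalize (fderiv ℝ F z) 1 = a at *
  generalize (fderiv ℝ F z) I = b at *
  simp at h1 h2
  apply Complex.ext
  · simp [pow_two]
    linarith
  · simp [pow_two]
    linarith

/-- The sign is global: the product of the analytic functions `Φ - ψ` and `Φ + ψ` vanishes on a
connected set, so one factor does. -/
theorem complexGradient_eq_or_neg {F : ℂ → ℝ} {ψ : ℂ → ℂ}
    (hF : InnerProductSpace.HarmonicOnNhd F (Metric.ball 0 1))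
    (hψ : AnalyticOnNhd ℂ ψ (Metric.ball 0 1))
    (h : ∀ z ∈ Metric.ball (0 : ℂ) 1, complexGradient F z ^ 2 = ψ z ^ 2) :
    ∃ ε : ℝ, ε ^ 2 = 1 ∧ ∀ z ∈ Metric.ball (0 : ℂ) 1, complexGradient F z = ε * ψ z := by
  have hΦ : AnalyticOnNhd ℂ (complexGradient F) (Metric.ball 0 1) :=
    fun z hz => HarmonicAt.analyticAt_complex_partial (hF z hz)
  rcases AnalyticOnNhd.eq_zero_or_eq_zero_of_mul_eq_zero (hΦ.sub hψ) (hΦ.add hψ)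
    (fun z hz => by
      simp only [Pi.sub_apply, Pi.add_apply]
      linear_combination h z hz) (convex_ball (0 : ℂ) 1).isPreconnected with h1 | h1
  · refine ⟨1, by norm_num, fun z hz => ?_⟩
    have := h1 z hz
    simp only [Pi.sub_apply] at this
    push_cast
    linear_combination this
  · refine ⟨-1, by norm_num, fun z hz => ?_⟩
    have := h1 z hz
    simp only [Pi.add_apply] at this
    push_cast
    linear_combination this

/-- The equation and its conjugate form a linear system for `G` and `conj G`. After `H` is cancelled
its determinant is, up to sign, `|k|⁴ - |l|⁴`, nonzero because `|l| < |k|`. -/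
theorem eq_of_gauss_equation {G e H k l : ℂ} {ε : ℝ} (he : ‖e‖ = 1)
    (hH : H ≠ 0) (hlk : ‖l‖ < ‖k‖)
    (h : G * (H * k ^ 2) + (starRingEnd ℂ) G * (-e ^ 2 * H * l ^ 2) = ε * (2 * e * H * k * l)) :
    G = 2 * ε * e * ((l / k) / (1 - normSq (l / k))) := by
  have hk : k ≠ 0 := norm_pos_iff.1 ((norm_nonneg l).trans_lt hlk)
  have hee : e * (starRingEnd ℂ) e = 1 := by rw [mul_conj, normSq_eq_norm_sq, he]; simp
  have h1 : G * k ^ 2 - (starRingEnd ℂ) G * e ^ 2 * l ^ 2 = ε * (2 * e * k * l) := by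
    refine mul_right_cancel₀ hH ?_
    linear_combination h
  have h2 := congrArg (starRingEnd ℂ) h1
  simp only [map_sub, map_mul, map_pow, map_ofNat, conj_ofReal, conj_conj] at h2
  have hK : k * (starRingEnd ℂ) k - l * (starRingEnd ℂ) l ≠ 0 := by
    rw [mul_conj, mul_conj, normSq_eq_norm_sq, normSq_eq_norm_sq, ← ofReal_sub]
    refine ofReal_ne_zero.2 (sub_ne_zero.2 (ne_of_gt ?_))
    gcongr
  have hK' : k * (starRingEnd ℂ) k + l * (starRingEnd ℂ) l ≠ 0 := by
    rw [mul_conj, mul_conj, normSq_eq_norm_sq, normSq_eq_norm_sq, ← ofReal_add]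
    refine ofReal_ne_zero.2 (ne_of_gt ?_)
    have : 0 < ‖k‖ := norm_pos_iff.2 hk
    positivity
  have hkc : (starRingEnd ℂ) k ≠ 0 := (map_ne_zero _).2 hk
  have h3 : G * (k * (starRingEnd ℂ) k - l * (starRingEnd ℂ) l)
      = 2 * ε * e * (l * (starRingEnd ℂ) k) := by
    refine mul_right_cancel₀ hK' ?_
    linear_combination (starRingEnd ℂ) k ^ 2 * h1 + e ^ 2 * l ^ 2 * h2
      + (G * l ^ 2 * (starRingEnd ℂ) l ^ 2 * (e * (starRingEnd ℂ) e + 1)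
        + 2 * ε * e * l ^ 2 * (starRingEnd ℂ) k * (starRingEnd ℂ) l) * hee
  have h4 : 1 - (normSq (l / k) : ℂ)
      = (k * (starRingEnd ℂ) k - l * (starRingEnd ℂ) l) / (k * (starRingEnd ℂ) k) := by
    rw [← mul_conj, map_div₀]; field_simp
  rw [h4]
  rw [← mul_right_inj' hK]
  field_simp
  linear_combination h3

theorem hasFDerivAt_div_one_sub_normSq {w : ℂ} (hw : normSq w ≠ 1) :
    ∃ B : ℂ →L[ℝ] ℂ, HasFDerivAt (fun w : ℂ => w / (1 - normSq w)) B w ∧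
      ∀ v, B v = (v + w ^ 2 * (starRingEnd ℂ) v) / (1 - normSq w) ^ 2 := by
  have h0 : (1 - normSq w : ℂ) ≠ 0 := by
    rw [← ofReal_one, ← ofReal_sub]
    exact ofReal_ne_zero.2 (sub_ne_zero.2 hw.symm)
  have h1 : HasFDerivAt (fun w : ℂ => (1 - normSq w : ℂ))
      (-(w • (conjCLE : ℂ →L[ℝ] ℂ) + (starRingEnd ℂ) w • ContinuousLinearMap.id ℝ ℂ)) w := by
    have := ((hasFDerivAt_id (𝕜 := ℝ) w).mul (conjCLE.hasFDerivAt (x := w))).const_sub 1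
    refine this.congr_of_eventuallyEq (Filter.Eventually.of_forall fun x => ?_)
    simp [mul_conj]
  have h2 := (hasDerivAt_inv h0).hasFDerivAt.restrictScalars ℝ
  have h3 := (hasFDerivAt_id (𝕜 := ℝ) w).mul (h2.comp w h1)
  refine ⟨_, h3, fun v => ?_⟩
  have hn : (normSq w : ℂ) = w * (starRingEnd ℂ) w := (mul_conj w).symm
  simp
  rw [hn] at h0 ⊢
  field_simp
  ring

/-- The Jacobian determinant of a real linear map of the plane. -/
noncomputable def jacobian (L : ℂ →L[ℝ] ℂ) : ℝ := ((starRingEnd ℂ) (L 1) * L I).im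

theorem jacobian_comp (A L : ℂ →L[ℝ] ℂ) : jacobian (A.comp L) = jacobian A * jacobian L := by
  have h : ∀ v : ℂ, A v = v.re * A 1 + v.im * A I := by
    intro v
    have : v = v.re • (1 : ℂ) + v.im • I := by simp
    conv_lhs => rw [this, map_add, map_smul, map_smul]
    simp
  simp only [jacobian, ContinuousLinearMap.comp_apply]
  rw [h (L 1), h (L I)]
  simp
  ring

theorem jacobian_eq {L : ℂ →L[ℝ] ℂ} {a b : ℂ} (h : ∀ v, L v = a * v + b * (starRingEnd ℂ) v) :
    jacobian L = ‖a‖ ^ 2 - ‖b‖ ^ 2 := by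
  simp only [jacobian, h, ← normSq_eq_norm_sq, normSq_apply]
  simp
  ring

theorem hasFDerivAt_complexGradient {u : ℂ → ℝ} {w : ℂ} (hu : ContDiffAt ℝ 2 u w) :
    ∃ A : ℂ →L[ℝ] ℂ, HasFDerivAt (complexGradient u) A w ∧
      jacobian A = -(dx (dx u) w * dy (dy u) w - dy (dx u) w ^ 2) := by
  have h1 : DifferentiableAt ℝ (fderiv ℝ u) w :=
    (hu.fderiv_right (m := 1) (by norm_num)).differentiableAt (by norm_num)
  have h2 : ∀ v : ℂ, HasFDerivAt (fun z => fderiv ℝ u z v) ((fderiv ℝ (fderiv ℝ u) w).flip v) w := by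
    intro v
    have := h1.hasFDerivAt.clm_apply (hasFDerivAt_const v w)
    simpa using this
  have hx := ofRealCLM.hasFDerivAt.comp w (h2 1)
  have hy := (ofRealCLM.hasFDerivAt.comp w (h2 I)).const_mul I
  refine ⟨_, hx.sub hy, ?_⟩
  have hsymm := (hu.isSymmSndFDerivAt (by simp)) 1 I
  have e : ∀ v v' : ℂ, fderiv ℝ (fun z => fderiv ℝ u z v) w v' = fderiv ℝ (fderiv ℝ u) w v' v :=
    fun v v' => by rw [(h2 v).fderiv]; rfl
  have exx : dx (dx u) w = fderiv ℝ (fderiv ℝ u) w 1 1 := e 1 1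
  have exy : dy (dx u) w = fderiv ℝ (fderiv ℝ u) w I 1 := e 1 I
  have eyy : dy (dy u) w = fderiv ℝ (fderiv ℝ u) w I I := e I I
  rw [exx, exy, eyy]
  simp [jacobian, hsymm]
  ring

/-- The identity `hG` is differentiated and Jacobians are taken on both sides. The Jacobian of the
complex gradient is minus the Hessian determinant, so this yields `K`. With `ρ = |r|²` the
inclination factor is `(1 + ρ)/(1 - ρ)`. -/
theorem inclination_sq_mul_abs_gaussCurvature {u : ℂ → ℝ} {f r : ℂ → ℂ} {z h g r' c : ℂ}
    {L : ℂ →L[ℝ] ℂ} (hu : ContDiffAt ℝ 2 u (f z)) (hf : HasFDerivAt f L z)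
    (hL : ∀ v, L v = h * v + (starRingEnd ℂ) (g * v)) (hr : HasDerivAt r r' z)
    (hr1 : normSq (r z) < 1) (hh : h ≠ 0) (hg : ‖g‖ = normSq (r z) * ‖h‖) (hc : ‖c‖ = 2)
    (hG : ∀ᶠ w in nhds z, complexGradient u (f w) = c * (r w / (1 - normSq (r w)))) :
    inclination u (f z) ^ 2 * |gaussCurvature u (f z)|
      = 4 * ‖r'‖ ^ 2 / (‖h‖ ^ 2 * (1 - normSq (r z) ^ 2) ^ 2) := by
  obtain ⟨A, hA, hJ⟩ := hasFDerivAt_complexGradient hu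
  obtain ⟨B, hB, hB'⟩ := hasFDerivAt_div_one_sub_normSq hr1.ne
  have h1 := (hB.comp z (hr.hasFDerivAt.restrictScalars ℝ)).const_mul c
  have h2 := (hA.comp z hf).unique (h1.congr_of_eventuallyEq hG)
  have hρ0 := normSq_nonneg (r z)
  have hGz := hG.self_of_nhds
  have hgrad : dx u (f z) ^ 2 + dy u (f z) ^ 2 = 4 * normSq (r z) / (1 - normSq (r z)) ^ 2 := by
    have e1 : ‖complexGradient u (f z)‖ ^ 2 = dx u (f z) ^ 2 + dy u (f z) ^ 2 := by
      rw [← normSq_eq_norm_sq, normSq_apply, complexGradient]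
      simp
      ring
    rw [← e1, hGz, norm_mul, hc, norm_div, mul_pow, div_pow, ← normSq_eq_norm_sq (r z),
      ← ofReal_one, ← ofReal_sub, norm_real, Real.norm_eq_abs, sq_abs]
    ring
  have hjac : -(dx (dx u) (f z) * dy (dy u) (f z) - dy (dx u) (f z) ^ 2)
      * (‖h‖ ^ 2 - (normSq (r z) * ‖h‖) ^ 2)
      = 4 * ‖r'‖ ^ 2 * (1 - normSq (r z) ^ 2) / (1 - normSq (r z)) ^ 4 := by
    have hLj : jacobian L = ‖h‖ ^ 2 - ‖g‖ ^ 2 := by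
      rw [jacobian_eq (a := h) (b := (starRingEnd ℂ) g) fun v => by rw [hL, map_mul], norm_conj]
    rw [← hJ, ← hg, ← hLj, ← jacobian_comp, h2,
      jacobian_eq (a := c * r' / (1 - normSq (r z)) ^ 2)
        (b := c * (r z ^ 2 * (starRingEnd ℂ) r') / (1 - normSq (r z)) ^ 2)]
    · rw [norm_div, norm_div, norm_pow, ← ofReal_one, ← ofReal_sub, norm_real, Real.norm_eq_abs,
        sq_abs, norm_mul, norm_mul, norm_mul, norm_pow, norm_conj, hc, ← normSq_eq_norm_sq]
      have : (1 - normSq (r z)) ≠ 0 := by linarith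
      field_simp
      ring
    · intro v
      have e : (c • B.comp (ContinuousLinearMap.restrictScalars ℝ
        (ContinuousLinearMap.toSpanSingleton ℂ r'))) v = c * B (v * r') := rfl
      rw [e, hB', map_mul]
      ring
  generalize normSq (r z) = ρ at *
  have hW : 1 + dx u (f z) ^ 2 + dy u (f z) ^ 2 = ((1 + ρ) / (1 - ρ)) ^ 2 := by
    rw [add_assoc, hgrad]
    have : 1 - ρ ≠ 0 := by linarith
    field_simp
    ring
  rw [inclination, gaussCurvature, hW, Real.sq_sqrt (by positivity), abs_div]
  generalize dx (dx u) (f z) * dy (dy u) (f z) - dy (dx u) (f z) ^ 2 = K at *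
  have hh0 : 0 < ‖h‖ := norm_pos_iff.2 hh
  have h1ρ : 0 < 1 - ρ := by linarith
  have h2ρ : 0 < 1 + ρ := by linarith
  have hK : |K| = 4 * ‖r'‖ ^ 2 / (‖h‖ ^ 2 * (1 - ρ) ^ 4) := by
    have : -K = 4 * ‖r'‖ ^ 2 / (‖h‖ ^ 2 * (1 - ρ) ^ 4) := by
      have h3 : ‖h‖ ^ 2 - (ρ * ‖h‖) ^ 2 = ‖h‖ ^ 2 * ((1 - ρ) * (1 + ρ)) := by ring
      rw [h3] at hjac
      have h4 : (1 - ρ ^ 2) = (1 - ρ) * (1 + ρ) := by ring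
      rw [h4] at hjac
      rw [eq_div_iff (by positivity)]
      rw [eq_div_iff (by positivity)] at hjac
      refine mul_right_cancel₀ (by positivity : (1 - ρ) * (1 + ρ) ≠ 0) ?_
      linear_combination hjac
    rw [← abs_neg, this, abs_of_nonneg (by positivity)]
  rw [hK, abs_of_nonneg (by positivity), show 1 - ρ ^ 2 = (1 - ρ) * (1 + ρ) by ring]
  field_simp

end Curvature

/-! ### The curvature at the point over the center -/

section Conclusion

open Complex

theorem arcAngle_trig {p q : ℝ} (hX : 0 < Real.sin p) (hY : 0 < Real.sin (q - p)) :
    0 < Real.sin (arcAngle p q / 2) ∧ 0 < Real.cos (arcAngle p q / 2) ∧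
      Real.sin p = (Real.sin p + Real.sin (q - p)) * Real.sin (arcAngle p q / 2) ^ 2 ∧
      Real.sin (q - p) = (Real.sin p + Real.sin (q - p)) * Real.cos (arcAngle p q / 2) ^ 2 := by
  have hα : arcAngle p q / 2 = Real.arctan √(Real.sin p / Real.sin (q - p)) := by
    rw [arcAngle]; ring
  rw [hα]
  generalize Real.sin p = X at *
  generalize Real.sin (q - p) = Y at *
  have hc : Real.cos (Real.arctan √(X / Y)) ^ 2 = Y / (X + Y) := by
    rw [Real.cos_sq_arctan, Real.sq_sqrt (by positivity)]
    field_simp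
    ring
  have hs : Real.sin (Real.arctan √(X / Y)) ^ 2 = X / (X + Y) := by
    rw [Real.sin_sq, hc]
    field_simp
    ring
  refine ⟨?_, Real.cos_arctan_pos _, ?_, ?_⟩
  · rw [Real.sin_arctan]
    have : 0 < √(X / Y) := Real.sqrt_pos.2 (by positivity)
    positivity
  · rw [hs]; field_simp
  · rw [hc]; field_simp

theorem arcAngle_mem {p q : ℝ} (hX : 0 < Real.sin p) (hY : 0 < Real.sin (q - p)) :
    0 < arcAngle p q ∧ arcAngle p q < Real.pi := by
  have h1 : 0 < √(Real.sin p / Real.sin (q - p)) := Real.sqrt_pos.2 (by positivity)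
  have h2 := Real.arctan_pos.2 h1
  have h3 := Real.arctan_lt_pi_div_two √(Real.sin p / Real.sin (q - p))
  constructor <;> rw [arcAngle] <;> linarith

/-- The product of the distances of `z` to the four jumps of the boundary function. -/
noncomputable def jumpProduct (α : ℝ) (z : ℂ) : ℝ :=
  ‖boundaryFactor 0 z‖ * ‖boundaryFactor α z‖ * ‖boundaryFactor Real.pi z‖
    * ‖boundaryFactor (Real.pi + α) z‖

theorem norm_sub_exp (t : ℝ) (z : ℂ) : ‖z - exp (t * I)‖ = ‖boundaryFactor t z‖ := by
  rw [norm_sub_rev]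
  have := congrArg norm (circleMap_sub_eq t z)
  rw [norm_mul, norm_exp_ofReal_mul_I, one_mul] at this
  rw [← this]
  simp [circleMap]

theorem norm_denominator (α : ℝ) (z : ℂ) :
    ‖(z ^ 2 - 1) * (z ^ 2 - exp ((α / 2 : ℝ) * I) ^ 4)‖ = jumpProduct α z := by
  have hE : exp ((α / 2 : ℝ) * I) ^ 2 = exp (α * I) := by
    rw [← exp_nat_mul]; congr 1; push_cast; ring
  have hE' : exp ((Real.pi + α : ℝ) * I) = -exp (α * I) := by
    rw [ofReal_add, add_mul, exp_add, exp_pi_mul_I]; ring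
  rw [jumpProduct, ← norm_sub_exp, ← norm_sub_exp, ← norm_sub_exp, ← norm_sub_exp, hE',
    exp_pi_mul_I, ofReal_zero, zero_mul, exp_zero, ← norm_mul, ← norm_mul, ← norm_mul, ← hE]
  congr 1
  ring

theorem jumpProduct_pos {z : ℂ} (hz : ‖z‖ < 1) (α : ℝ) : 0 < jumpProduct α z := by
  have := fun t => norm_pos_iff.2 (boundaryFactor_ne_zero hz t)
  exact mul_pos (mul_pos (mul_pos (this _) (this _)) (this _)) (this _)

theorem arcWeight_trig (α : ℝ) (z : ℂ) :
    (‖boundaryFactor 0 z‖ * ‖boundaryFactor α z‖ * Real.sin (arcWeight 0 α z)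
        = Real.sin (α / 2) * (1 - ‖z‖ ^ 2) ∧
      ‖boundaryFactor α z‖ * ‖boundaryFactor Real.pi z‖ * Real.sin (arcWeight α Real.pi z)
        = Real.cos (α / 2) * (1 - ‖z‖ ^ 2) ∧
      ‖boundaryFactor Real.pi z‖ * ‖boundaryFactor (Real.pi + α) z‖
        * Real.sin (arcWeight Real.pi (Real.pi + α) z) = Real.sin (α / 2) * (1 - ‖z‖ ^ 2) ∧
      ‖boundaryFactor (Real.pi + α) z‖ * ‖boundaryFactor 0 z‖
        * Real.sin (arcWeight (Real.pi + α) (2 * Real.pi) z)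
        = Real.cos (α / 2) * (1 - ‖z‖ ^ 2)) ∧
    (‖boundaryFactor 0 z‖ * ‖boundaryFactor α z‖ * Real.cos (arcWeight 0 α z)
        = Real.cos (α / 2) * (1 + ‖z‖ ^ 2) - 2 * (z * exp (-(α / 2 : ℝ) * I)).re ∧
      ‖boundaryFactor α z‖ * ‖boundaryFactor Real.pi z‖ * Real.cos (arcWeight α Real.pi z)
        = Real.sin (α / 2) * (1 + ‖z‖ ^ 2) - 2 * (z * exp (-(α / 2 : ℝ) * I)).im ∧
      ‖boundaryFactor Real.pi z‖ * ‖boundaryFactor (Real.pi + α) z‖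
        * Real.cos (arcWeight Real.pi (Real.pi + α) z)
        = Real.cos (α / 2) * (1 + ‖z‖ ^ 2) + 2 * (z * exp (-(α / 2 : ℝ) * I)).re ∧
      ‖boundaryFactor (Real.pi + α) z‖ * ‖boundaryFactor 0 z‖
        * Real.cos (arcWeight (Real.pi + α) (2 * Real.pi) z)
        = Real.sin (α / 2) * (1 + ‖z‖ ^ 2) + 2 * (z * exp (-(α / 2 : ℝ) * I)).im) := by
  have a1 : (α - 0) / 2 = α / 2 := by ring
  have a2 : (Real.pi - α) / 2 = Real.pi / 2 - α / 2 := by ring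
  have a3 : (Real.pi + α - Real.pi) / 2 = α / 2 := by ring
  have a4 : (2 * Real.pi - (Real.pi + α)) / 2 = Real.pi / 2 - α / 2 := by ring
  have e2 : exp (-(((α + Real.pi) / 2 : ℝ) : ℂ) * I) = -I * exp (-(α / 2 : ℝ) * I) := by
    rw [← exp_neg_pi_div_two_mul_I, ← exp_add]; congr 1; push_cast; ring
  have e3 : exp (-(((Real.pi + (Real.pi + α)) / 2 : ℝ) : ℂ) * I) = -exp (-(α / 2 : ℝ) * I) := by
    rw [← neg_one_mul (exp _), ← exp_neg_pi_mul_I, ← exp_add]; congr 1; push_cast; ring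
  have e4 : exp (-(((Real.pi + α + 2 * Real.pi) / 2 : ℝ) : ℂ) * I)
      = I * exp (-(α / 2 : ℝ) * I) := by
    have : exp (-(((Real.pi + α + 2 * Real.pi) / 2 : ℝ) : ℂ) * I)
        = exp (-(Real.pi * I)) * (exp (-Real.pi / 2 * I) * exp (-(α / 2 : ℝ) * I)) := by
      rw [← exp_add, ← exp_add]; congr 1; push_cast; ring
    rw [this, exp_neg_pi_mul_I, exp_neg_pi_div_two_mul_I]; ring
  have s1 := norm_mul_sin_arcWeight z 0 α
  have s2 := norm_mul_sin_arcWeight z α Real.pi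
  have s3 := norm_mul_sin_arcWeight z Real.pi (Real.pi + α)
  have s4 := norm_mul_sin_arcWeight z (Real.pi + α) (2 * Real.pi)
  have c1 := norm_mul_cos_arcWeight z 0 α
  have c2 := norm_mul_cos_arcWeight z α Real.pi
  have c3 := norm_mul_cos_arcWeight z Real.pi (Real.pi + α)
  have c4 := norm_mul_cos_arcWeight z (Real.pi + α) (2 * Real.pi)
  rw [a1] at s1 c1
  rw [a2, Real.sin_pi_div_two_sub] at s2
  rw [a2, Real.cos_pi_div_two_sub, e2] at c2
  rw [a3] at s3 c3
  rw [e3] at c3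
  rw [a4, Real.sin_pi_div_two_sub, boundaryFactor_two_pi] at s4
  rw [a4, Real.cos_pi_div_two_sub, boundaryFactor_two_pi, e4] at c4
  rw [zero_add] at c1
  refine ⟨⟨s1, s2, s3, s4⟩, c1, ?_, ?_, ?_⟩
  · rw [c2, show z * (-I * exp (-(α / 2 : ℝ) * I)) = -I * (z * exp (-(α / 2 : ℝ) * I)) by ring]
    simp
  · rw [c3, mul_neg, neg_re]; ring
  · rw [c4, show z * (I * exp (-(α / 2 : ℝ) * I)) = I * (z * exp (-(α / 2 : ℝ) * I)) by ring]
    simp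
    ring

/-- After multiplication by the product of the four distances, the two sides are `Y sin² (α/2)` and
`X cos² (α/2)` times the same factor `(1 - |z|²)²`; they agree since `tan² (α/2) = X / Y`. -/
theorem sin_mul_sin_arcWeight_eq {z : ℂ} (hz : ‖z‖ < 1) {X Y α : ℝ}
    (hX : X = (X + Y) * Real.sin (α / 2) ^ 2) (hY : Y = (X + Y) * Real.cos (α / 2) ^ 2) :
    Y * (Real.sin (arcWeight 0 α z) * Real.sin (arcWeight Real.pi (Real.pi + α) z))
      = X * (Real.sin (arcWeight α Real.pi z)
        * Real.sin (arcWeight (Real.pi + α) (2 * Real.pi) z)) := by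
  obtain ⟨⟨s1, s2, s3, s4⟩, -⟩ := arcWeight_trig α z
  refine mul_left_cancel₀ (jumpProduct_pos hz α).ne' ?_
  generalize Real.sin (arcWeight 0 α z) = S1 at *
  generalize Real.sin (arcWeight α Real.pi z) = S2 at *
  generalize Real.sin (arcWeight Real.pi (Real.pi + α) z) = S3 at *
  generalize Real.sin (arcWeight (Real.pi + α) (2 * Real.pi) z) = S4 at *
  have e1 : jumpProduct α z * (S1 * S3) = Real.sin (α / 2) ^ 2 * (1 - ‖z‖ ^ 2) ^ 2 := by
    rw [show jumpProduct α z * (S1 * S3) = (‖boundaryFactor 0 z‖ * ‖boundaryFactor α z‖ * S1)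
      * (‖boundaryFactor Real.pi z‖ * ‖boundaryFactor (Real.pi + α) z‖ * S3) by
        rw [jumpProduct]; ring, s1, s3]
    ring
  have e2 : jumpProduct α z * (S2 * S4) = Real.cos (α / 2) ^ 2 * (1 - ‖z‖ ^ 2) ^ 2 := by
    rw [show jumpProduct α z * (S2 * S4) = (‖boundaryFactor α z‖ * ‖boundaryFactor Real.pi z‖ * S2)
      * (‖boundaryFactor (Real.pi + α) z‖ * ‖boundaryFactor 0 z‖ * S4) by
        rw [jumpProduct]; ring, s2, s4]
    ring
  generalize Real.sin (α / 2) ^ 2 = a at *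
  generalize Real.cos (α / 2) ^ 2 = b at *
  linear_combination Y * e1 - X * e2 + (1 - ‖z‖ ^ 2) ^ 2 * (a * hY - b * hX)

/-- Opposite arcs together use each of the four jumps once, so the distances in the products of
sines and cosines combine to `jumpProduct`. The result is the expression found for `|k|² + |j|²` in
`exists_sqrt_data`. -/
theorem jumpProduct_mul_slopeSum (X Y c d α : ℝ) (z : ℂ) :
    jumpProduct α z * slopeSum X Y c d
        (arcWeight 0 α z + arcWeight Real.pi (Real.pi + α) z)
        (arcWeight 0 α z - arcWeight Real.pi (Real.pi + α) z)
        (arcWeight α Real.pi z - arcWeight (Real.pi + α) (2 * Real.pi) z)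
      = (1 - ‖z‖ ^ 2) * (2 * ((X + Y) * Real.sin (α / 2) * Real.cos (α / 2)) * (1 + ‖z‖ ^ 2)
        + 4 * (Y * c * Real.sin (α / 2) * (z * exp (-(α / 2 : ℝ) * I)).re
          + X * d * Real.cos (α / 2) * (z * exp (-(α / 2 : ℝ) * I)).im)) := by
  obtain ⟨⟨s1, s2, s3, s4⟩, c1, c2, c3, c4⟩ := arcWeight_trig α z
  rw [slopeSum, Real.sin_add, Real.sin_sub, Real.sin_sub, jumpProduct]
  generalize Real.sin (arcWeight 0 α z) = S1 at *
  generalize Real.sin (arcWeight α Real.pi z) = S2 at *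
  generalize Real.sin (arcWeight Real.pi (Real.pi + α) z) = S3 at *
  generalize Real.sin (arcWeight (Real.pi + α) (2 * Real.pi) z) = S4 at *
  generalize Real.cos (arcWeight 0 α z) = C1 at *
  generalize Real.cos (arcWeight α Real.pi z) = C2 at *
  generalize Real.cos (arcWeight Real.pi (Real.pi + α) z) = C3 at *
  generalize Real.cos (arcWeight (Real.pi + α) (2 * Real.pi) z) = C4 at *
  generalize ‖boundaryFactor 0 z‖ = b0 at *
  generalize ‖boundaryFactor α z‖ = b1 at *
  generalize ‖boundaryFactor Real.pi z‖ = b2 at *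
  generalize ‖boundaryFactor (Real.pi + α) z‖ = b3 at *
  calc b0 * b1 * b2 * b3 * ((X + Y) * (S1 * C3 + C1 * S3) + Y * c * (S1 * C3 - C1 * S3)
        + X * d * (S2 * C4 - C2 * S4))
      = (X + Y) * ((b0 * b1 * S1) * (b2 * b3 * C3) + (b0 * b1 * C1) * (b2 * b3 * S3))
        + Y * c * ((b0 * b1 * S1) * (b2 * b3 * C3) - (b0 * b1 * C1) * (b2 * b3 * S3))
        + X * d * ((b1 * b2 * S2) * (b3 * b0 * C4) - (b1 * b2 * C2) * (b3 * b0 * S4)) := by ring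
    _ = _ := by
      rw [s1, s2, s3, s4, c1, c2, c3, c4]
      ring

theorem norm_sq_sub_norm_sq_eq (l m z : ℂ) :
    ‖l * z + m‖ ^ 2 - ‖(starRingEnd ℂ) l + (starRingEnd ℂ) m * z‖ ^ 2
      = (‖m‖ ^ 2 - ‖l‖ ^ 2) * (1 - ‖z‖ ^ 2) := by
  simp only [← normSq_eq_norm_sq, normSq_apply, add_re, add_im, mul_re, mul_im, conj_re, conj_im]
  ring

theorem norm_lt_of_norm_lt {l m z : ℂ} (hlm : ‖l‖ < ‖m‖) (hz : ‖z‖ < 1) :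
    ‖(starRingEnd ℂ) l + (starRingEnd ℂ) m * z‖ < ‖l * z + m‖ := by
  refine lt_of_pow_lt_pow_left₀ 2 (norm_nonneg _) ?_
  have h1 : ‖l‖ ^ 2 < ‖m‖ ^ 2 := by gcongr
  have h2 : ‖z‖ ^ 2 < 1 := pow_lt_one₀ (norm_nonneg z) hz two_ne_zero
  have := mul_pos (sub_pos.2 h1) (sub_pos.2 h2)
  rw [← norm_sq_sub_norm_sq_eq l m z] at this
  linarith

theorem vertex_sqrt_data {p q : ℝ} (hp : 0 < p) (hpq : p < q) (hq : q ≤ Real.pi) :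
    ∃ l m : ℂ,
      l ^ 2 = (vertex p q 0 + vertex p q 3 - vertex p q 1 - vertex p q 2)
        * exp ((arcAngle p q / 2 : ℝ) * I) ^ 2
        + (vertex p q 2 + vertex p q 3 - vertex p q 0 - vertex p q 1) ∧
      m ^ 2 = -((vertex p q 0 + vertex p q 3 - vertex p q 1 - vertex p q 2)
        * exp ((arcAngle p q / 2 : ℝ) * I) ^ 2
        + (vertex p q 2 + vertex p q 3 - vertex p q 0 - vertex p q 1)
        * exp ((arcAngle p q / 2 : ℝ) * I) ^ 4) ∧
      2 * (l * m) = (vertex p q 0 + vertex p q 2 - vertex p q 1 - vertex p q 3)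
        * (exp ((arcAngle p q / 2 : ℝ) * I) ^ 4 - 1) ∧
      ‖l‖ < ‖m‖ ∧ ∀ z : ℂ,
        (1 - ‖z‖ ^ 2) * (√(1 + Real.sin p * Real.sin (q - p)) / 4
          * (‖l * z + m‖ ^ 2 + ‖(starRingEnd ℂ) l + (starRingEnd ℂ) m * z‖ ^ 2))
        = jumpProduct (arcAngle p q) z
          * slopeSum (Real.sin p) (Real.sin (q - p)) (Real.cos p) (Real.cos (q - p))
            (arcWeight 0 (arcAngle p q) z + arcWeight Real.pi (Real.pi + arcAngle p q) z)
            (arcWeight 0 (arcAngle p q) z - arcWeight Real.pi (Real.pi + arcAngle p q) z)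
            (arcWeight (arcAngle p q) Real.pi z
              - arcWeight (Real.pi + arcAngle p q) (2 * Real.pi) z) := by
  obtain ⟨hX, hY⟩ := sin_pos_of_lt hp hpq hq
  obtain ⟨hs, hk, hXs, hYk⟩ := arcAngle_trig hX hY
  obtain ⟨hu, hv⟩ := halfTilt_trig hp hpq hq
  have hw : exp ((2 * halfTilt p q : ℝ) * I) * (1 + Real.sin p * Real.sin (q - p))
      = Real.cos p * Real.cos (q - p) + (Real.sin p + Real.sin (q - p)) * I := by
    rw [exp_mul_I, ← ofReal_cos, ← ofReal_sin]
    have hu' := congrArg ofReal hu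
    have hv' := congrArg ofReal hv
    push_cast at hu' hv' ⊢
    linear_combination hu' + I * hv'
  have hE : exp ((arcAngle p q / 2 : ℝ) * I)
      = Real.cos (arcAngle p q / 2) + Real.sin (arcAngle p q / 2) * I := by
    rw [exp_mul_I, ofReal_cos, ofReal_sin]
  have hEc : (starRingEnd ℂ) (exp ((arcAngle p q / 2 : ℝ) * I))
      = exp (-(arcAngle p q / 2 : ℝ) * I) := by
    rw [← exp_conj, map_mul, conj_ofReal, conj_I]; ring_nf
  obtain ⟨l, m, hl, hm, hlm, hlt, hz⟩ := exists_sqrt_data hX hY (Real.sin_sq_add_cos_sq p)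
    (Real.sin_sq_add_cos_sq (q - p)) hs hk (Real.sin_sq_add_cos_sq _) hXs hYk hw hE
  have v0 : vertex p q 0 = exp ((2 * halfTilt p q : ℝ) * I)
      * (Real.cos (q - p) + Real.sin (q - p) * I) := by
    rw [ofReal_cos, ofReal_sin, ← exp_mul_I, ← exp_add]
    simp only [vertex, Matrix.cons_val_zero]
    congr 1; push_cast; ring
  have v2 : vertex p q 2 = exp ((2 * halfTilt p q : ℝ) * I)
      * (Real.cos (q - p) - Real.sin (q - p) * I) := by
    rw [ofReal_cos, ofReal_sin, sub_eq_add_neg, ← neg_mul, ← sin_neg, ← cos_neg, ← exp_mul_I,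
      ← exp_add]
    simp only [vertex, Matrix.cons_val]
    congr 1; push_cast; ring
  have v3 : vertex p q 3 = Real.cos p + Real.sin p * I := by
    rw [ofReal_cos, ofReal_sin, ← exp_mul_I]; rfl
  have v1 : vertex p q 1 = Real.cos p - Real.sin p * I := by
    rw [ofReal_cos, ofReal_sin, sub_eq_add_neg, ← neg_mul, ← sin_neg, ← cos_neg, ← exp_mul_I,
      ← ofReal_neg]
    rfl
  have hsk : (Real.sin (arcAngle p q / 2) : ℂ) ^ 2 + Real.cos (arcAngle p q / 2) ^ 2 = 1 := by
    exact_mod_cast congrArg ofReal (Real.sin_sq_add_cos_sq (arcAngle p q / 2))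
  have hXsC : (Real.sin p : ℂ)
      = (Real.sin p + Real.sin (q - p)) * Real.sin (arcAngle p q / 2) ^ 2 := by
    exact_mod_cast congrArg ofReal hXs
  have hYkC : (Real.sin (q - p) : ℂ)
      = (Real.sin p + Real.sin (q - p)) * Real.cos (arcAngle p q / 2) ^ 2 := by
    exact_mod_cast congrArg ofReal hYk
  generalize exp ((arcAngle p q / 2 : ℝ) * I) = E at *
  generalize exp ((2 * halfTilt p q : ℝ) * I) = w at *
  have eA : E ^ 2 - 1 = 2 * I * Real.sin (arcAngle p q / 2) * E := by
    rw [hE]; linear_combination hsk - (Real.sin (arcAngle p q / 2) : ℂ) ^ 2 * I_sq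
  have eB : E ^ 2 + 1 = 2 * Real.cos (arcAngle p q / 2) * E := by
    rw [hE]; linear_combination -hsk + (Real.sin (arcAngle p q / 2) : ℂ) ^ 2 * I_sq
  refine ⟨l, m, ?_, ?_, ?_, hlt, fun z => ?_⟩
  · rw [hl, v0, v1, v2, v3]
    generalize (Real.sin (arcAngle p q / 2) : ℂ) = s at *
    generalize (Real.cos (arcAngle p q / 2) : ℂ) = k at *
    linear_combination (-2 * I * Real.sin (q - p) * w) * eA - 2 * I * Real.sin p * eB
      - 4 * I * k * E * hXsC - 4 * I ^ 2 * s * E * w * hYkC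
  · rw [hm, v0, v1, v2, v3]
    generalize (Real.sin (arcAngle p q / 2) : ℂ) = s at *
    generalize (Real.cos (arcAngle p q / 2) : ℂ) = k at *
    linear_combination (-2 * I * E ^ 2 * Real.sin (q - p) * w) * eA
      + 2 * I * E ^ 2 * Real.sin p * eB
      + 4 * I * E ^ 3 * k * hXsC - 4 * I ^ 2 * E ^ 3 * s * w * hYkC
  · rw [hlm, v0, v1, v2, v3]
    generalize (Real.sin (arcAngle p q / 2) : ℂ) = s at *
    generalize (Real.cos (arcAngle p q / 2) : ℂ) = k at *
    linear_combination (-2 * (Real.cos (q - p) * w - Real.cos p))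
      * ((E ^ 2 + 1) * eA + 2 * I * s * E * eB)
  · rw [hz, jumpProduct_mul_slopeSum, hEc]

/-- This holds at every point of the disk; the balance at the center enters only afterwards. The
moduli of `r'`, `f_z` and `1 - |r|⁴` combine so that only `|k|² + |j|²`, `1 - |z|²` and
`jumpProduct` survive. -/
theorem IsScherkGraph.curvature_eq {p q : ℝ} (hp : 0 < p) (hpq : p < q) (hq : q ≤ Real.pi)
    {u : ℂ → ℝ} (hu : IsScherkGraph p q u) {z : ℂ} (hz : ‖z‖ < 1) :
    inclination u (horizontalProjection p q z) ^ 2 *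
        |gaussCurvature u (horizontalProjection p q z)|
      = Real.pi ^ 2 * (1 + Real.sin p * Real.sin (q - p))
        / slopeSum (Real.sin p) (Real.sin (q - p)) (Real.cos p) (Real.cos (q - p))
            (arcWeight 0 (arcAngle p q) z + arcWeight Real.pi (Real.pi + arcAngle p q) z)
            (arcWeight 0 (arcAngle p q) z - arcWeight Real.pi (Real.pi + arcAngle p q) z)
            (arcWeight (arcAngle p q) Real.pi z
              - arcWeight (Real.pi + arcAngle p q) (2 * Real.pi) z) ^ 2 := by
  obtain ⟨hX, hY⟩ := sin_pos_of_lt hp hpq hq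
  obtain ⟨l, m, hl, hm, hlm, hlt, hnum⟩ := vertex_sqrt_data hp hpq hq
  have hE : ‖exp ((arcAngle p q / 2 : ℝ) * I)‖ = 1 := norm_exp_ofReal_mul_I _
  have hden := norm_denominator (arcAngle p q)
  have hderiv := fun w (hw : ‖w‖ < 1) => hasFDerivAt_horizontalProjection (p := p) (q := q) hw
  generalize exp ((arcAngle p q / 2 : ℝ) * I) = E at *
  obtain ⟨H, hH⟩ : ∃ H : ℂ → ℂ, H = fun w =>
    (2 * Real.pi * I)⁻¹ / ((w ^ 2 - 1) * (w ^ 2 - E ^ 4)) := ⟨_, rfl⟩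
  obtain ⟨k, hk⟩ : ∃ k : ℂ → ℂ, k = fun w => l * w + m := ⟨_, rfl⟩
  obtain ⟨j, hj⟩ : ∃ j : ℂ → ℂ, j = fun w => (starRingEnd ℂ) l + (starRingEnd ℂ) m * w := ⟨_, rfl⟩
  have hπ : (Real.pi : ℂ) ≠ 0 := ofReal_ne_zero.2 Real.pi_ne_zero
  have hH0 : ∀ w, ‖w‖ < 1 → H w ≠ 0 := fun w hw => by
    rw [hH]
    exact div_ne_zero (inv_ne_zero (by simp [hπ])) (denominator_ne_zero hE hw)
  have hjk : ∀ w, ‖w‖ < 1 → ‖j w‖ < ‖k w‖ := fun w hw => by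
    rw [hj, hk]; exact norm_lt_of_norm_lt hlt hw
  have hf : ∀ w, ‖w‖ < 1 → ∃ L : ℂ →L[ℝ] ℂ, HasFDerivAt (horizontalProjection p q) L w ∧
      ∀ v, L v = H w * k w ^ 2 * v + (starRingEnd ℂ) (-(E ^ 2) ^ 2 * H w * j w ^ 2 * v) := by
    intro w hw
    obtain ⟨L, h1, h2⟩ := hderiv w hw
    refine ⟨L, h1, fun v => ?_⟩
    rw [h2, stepSum_eq_sq hE hw hl hm hlm, stepSum_conj_eq_sq hE hw hl hm hlm, hH, hk, hj]
    congr 1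
    · ring
    · congr 1; ring
  have hopen : IsOpen (quadrilateral p q) := isOpen_interior
  have hmem : ∀ w, ‖w‖ < 1 → horizontalProjection p q w ∈ quadrilateral p q :=
    fun w hw => hu.bijOn.mapsTo (by simpa using hw)
  have huC : ∀ w, ‖w‖ < 1 → ContDiffAt ℝ 2 u (horizontalProjection p q w) :=
    fun w hw => hu.minimal.1.contDiffAt (hopen.mem_nhds (hmem w hw))
  -- This function is a holomorphic square root of `-4 f_z conj f_z̄ = 4 E⁴ H² k² j²`.
  have hψ : AnalyticOnNhd ℂ (fun w => 2 * E ^ 2 * H w * k w * j w) (Metric.ball 0 1) := by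
    refine DifferentiableOn.analyticOnNhd (fun w hw => ?_) Metric.isOpen_ball
    have hw' : ‖w‖ < 1 := by simpa using hw
    have := denominator_ne_zero hE hw'
    rw [hH, hk, hj]
    refine DifferentiableAt.differentiableWithinAt ?_
    fun_prop (disch := exact this)
  obtain ⟨ε, hε, hΦ⟩ := complexGradient_eq_or_neg hu.harmonic hψ fun w hw => by
    obtain ⟨L, h1, h2⟩ := hf w (by simpa using hw)
    rw [sq_eq_of_isothermal h1 h2 (hu.isothermal w hw)]
    ring
  have hG : ∀ w, ‖w‖ < 1 → complexGradient u (horizontalProjection p q w)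
      = 2 * ε * E ^ 2 * ((j w / k w) / (1 - normSq (j w / k w))) := by
    intro w hw
    obtain ⟨L, h1, h2⟩ := hf w hw
    have h3 := complexGradient_comp ((huC w hw).differentiableAt two_ne_zero) h1 h2
    rw [hΦ w (by simpa using hw)] at h3
    exact eq_of_gauss_equation (by rw [norm_pow, hE, one_pow]) (hH0 w hw) (hjk w hw) h3.symm
  obtain ⟨L, hL, hL'⟩ := hf z hz
  have hk0 : k z ≠ 0 := norm_pos_iff.1 ((norm_nonneg _).trans_lt (hjk z hz))
  have hr : HasDerivAt (fun w => j w / k w)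
      (((starRingEnd ℂ) m * k z - j z * l) / k z ^ 2) z := by
    have h1 : HasDerivAt k l z := by
      rw [hk]; simpa using ((hasDerivAt_id z).const_mul l).add_const m
    have h2 : HasDerivAt j ((starRingEnd ℂ) m) z := by
      rw [hj]; simpa using ((hasDerivAt_id z).const_mul ((starRingEnd ℂ) m)).const_add ((starRingEnd ℂ) l)
    exact h2.div h1 hk0
  have hkpos : 0 < ‖k z‖ := norm_pos_iff.2 hk0
  have hρ : normSq (j z / k z) = ‖j z‖ ^ 2 / ‖k z‖ ^ 2 := by
    rw [normSq_eq_norm_sq, norm_div, div_pow]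
  have hεn : |ε| = 1 := (sq_eq_sq₀ (abs_nonneg ε) zero_le_one).1 (by rw [sq_abs, hε, one_pow])
  have key := inclination_sq_mul_abs_gaussCurvature (huC z hz) hL hL' hr
    (by rw [hρ, div_lt_one (by positivity)]; have := hjk z hz; gcongr)
    (mul_ne_zero (hH0 z hz) (pow_ne_zero 2 hk0))
    (by rw [hρ]; simp [hE]; field_simp)
    (c := 2 * ε * E ^ 2) (by simp [hE, hεn])
    (by
      filter_upwards [(isOpen_lt continuous_norm continuous_const).mem_nhds hz] with w hw
      exact hG w hw)
  rw [key, hρ]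
  have hr' : ‖((starRingEnd ℂ) m * k z - j z * l) / k z ^ 2‖ = (‖m‖ ^ 2 - ‖l‖ ^ 2) / ‖k z‖ ^ 2 := by
    have : (starRingEnd ℂ) m * k z - j z * l = ((‖m‖ ^ 2 - ‖l‖ ^ 2 : ℝ) : ℂ) := by
      rw [← normSq_eq_norm_sq, ← normSq_eq_norm_sq, ofReal_sub, ← mul_conj, ← mul_conj, hk, hj]
      ring
    rw [norm_div, this, norm_pow, Complex.norm_of_nonneg]
    have : ‖l‖ ^ 2 < ‖m‖ ^ 2 := by gcongr
    linarith
  have hD := jumpProduct_pos hz (arcAngle p q)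
  have hHn : ‖H z * k z ^ 2‖ = ‖k z‖ ^ 2 / (2 * Real.pi * jumpProduct (arcAngle p q) z) := by
    rw [← hden, hH]
    simp [abs_of_pos Real.pi_pos]
    field_simp
  rw [hr', hHn]
  have hsub : ‖k z‖ ^ 2 - ‖j z‖ ^ 2 = (‖m‖ ^ 2 - ‖l‖ ^ 2) * (1 - ‖z‖ ^ 2) := by
    rw [hk, hj]; exact norm_sq_sub_norm_sq_eq l m z
  have hnumz := hnum z
  have hkj : ‖l * z + m‖ ^ 2 + ‖(starRingEnd ℂ) l + (starRingEnd ℂ) m * z‖ ^ 2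
      = ‖k z‖ ^ 2 + ‖j z‖ ^ 2 := by rw [hk, hj]
  rw [hkj] at hnumz
  have hN : 0 < 1 + Real.sin p * Real.sin (q - p) := by positivity
  have hn := Real.sq_sqrt hN.le
  have hn0 := Real.sqrt_pos.2 hN
  have hz2 : 0 < 1 - ‖z‖ ^ 2 := sub_pos.2 (pow_lt_one₀ (norm_nonneg z) hz two_ne_zero)
  have hml : 0 < ‖m‖ ^ 2 - ‖l‖ ^ 2 := sub_pos.2 (by gcongr)
  generalize slopeSum _ _ _ _ _ _ _ = T at *
  generalize jumpProduct (arcAngle p q) z = J at *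
  have hT : T = (1 - ‖z‖ ^ 2) * (√(1 + Real.sin p * Real.sin (q - p)) / 4
      * (‖k z‖ ^ 2 + ‖j z‖ ^ 2)) / J := by rw [hnumz]; field_simp
  generalize √(1 + Real.sin p * Real.sin (q - p)) = n at *
  rw [hT, ← hn]
  have h4 : 1 - (‖j z‖ ^ 2 / ‖k z‖ ^ 2) ^ 2
      = (‖m‖ ^ 2 - ‖l‖ ^ 2) * (1 - ‖z‖ ^ 2) * (‖k z‖ ^ 2 + ‖j z‖ ^ 2) / ‖k z‖ ^ 4 := by
    rw [← hsub]; field_simp; ring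
  rw [h4]
  have hπ' := Real.pi_pos
  generalize ‖m‖ ^ 2 - ‖l‖ ^ 2 = a at *
  generalize 1 - ‖z‖ ^ 2 = b at *
  have h5 : 0 < ‖k z‖ ^ 2 + ‖j z‖ ^ 2 := by positivity
  generalize ‖k z‖ ^ 2 + ‖j z‖ ^ 2 = t at *
  field_simp
  ring

end Conclusion

end Scherk

/-! ### The two bounds at the point over the center -/

theorem propositionB1 (p q : ℝ) (hpq : Scherk.Admissible p q)
    (u : ℂ → ℝ) (hu : Scherk.IsScherkGraph p q u) :
    Real.pi ^ 2 / 4 ≤ Scherk.inclination u 0 ^ 2 * |Scherk.gaussCurvature u 0| ∧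
      Scherk.inclination u 0 ^ 2 * |Scherk.gaussCurvature u 0| ≤ Real.pi ^ 2 / 2 := by
  obtain ⟨hp, hlt, hq, h0⟩ := hpq
  obtain ⟨z, hz, hfz⟩ := hu.bijOn.surjOn h0
  have hz : ‖z‖ < 1 := by simpa using hz
  obtain ⟨hX, hY⟩ := Scherk.sin_pos_of_lt hp hlt hq
  obtain ⟨hα0, hα1⟩ := Scherk.arcAngle_mem hX hY
  obtain ⟨-, -, hXs, hYk⟩ := Scherk.arcAngle_trig hX hY
  have hcurv := hu.curvature_eq hp hlt hq hz
  rw [hfz] at hcurv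
  rw [hcurv]
  have hπ := Real.pi_pos
  have hsum : Scherk.arcWeight 0 (Scherk.arcAngle p q) z
      + Scherk.arcWeight (Scherk.arcAngle p q) Real.pi z
      + Scherk.arcWeight Real.pi (Real.pi + Scherk.arcAngle p q) z
      + Scherk.arcWeight (Real.pi + Scherk.arcAngle p q) (2 * Real.pi) z = Real.pi := by
    rw [Scherk.arcWeight_add_arcWeight, Scherk.arcWeight_add_arcWeight,
      Scherk.arcWeight_add_arcWeight, Scherk.arcWeight_circle]
  -- The equation `f z = 0`, multiplied by `π`.
  have hbal : (Scherk.arcWeight 0 (Scherk.arcAngle p q) z : ℂ) * Scherk.vertex p q 0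
      + Scherk.arcWeight (Scherk.arcAngle p q) Real.pi z * Scherk.vertex p q 1
      + Scherk.arcWeight Real.pi (Real.pi + Scherk.arcAngle p q) z * Scherk.vertex p q 2
      + Scherk.arcWeight (Real.pi + Scherk.arcAngle p q) (2 * Real.pi) z * Scherk.vertex p q 3
        = 0 := by
    have hπC : (Real.pi : ℂ) ≠ 0 := Complex.ofReal_ne_zero.2 hπ.ne'
    simp only [Scherk.horizontalProjection, Scherk.harmonicMeasure_eq hz, Complex.real_smul,
      Complex.ofReal_div] at hfz
    field_simp at hfz
    rw [mul_comm Real.pi 2] at hfz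
    linear_combination hfz
  obtain ⟨h1, h2⟩ := Scherk.slopeSum_bounds_of_balance hp hlt hq
    (Scherk.arcWeight_pos hz hα0).le (Scherk.arcWeight_pos hz hα1).le
    (Scherk.arcWeight_pos hz (by linarith)).le (Scherk.arcWeight_pos hz (by linarith)).le hsum hbal
    (Scherk.sin_mul_sin_arcWeight_eq hz hXs hYk)
  have hN : 0 < 1 + Real.sin p * Real.sin (q - p) := by positivity
  have hT : 0 < √(2 * (1 + Real.sin p * Real.sin (q - p))) := Real.sqrt_pos.2 (by positivity)
  have hs1 := Real.sq_sqrt (show 0 ≤ 2 * (1 + Real.sin p * Real.sin (q - p)) by positivity)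
  have hs2 := Real.sq_sqrt hN.le
  generalize Scherk.slopeSum _ _ _ _ _ _ _ = T at *
  have hT0 : 0 < T := hT.trans_le h1
  have h3 : 2 * (1 + Real.sin p * Real.sin (q - p)) ≤ T ^ 2 := by rw [← hs1]; gcongr
  have h4 : T ^ 2 ≤ 4 * (1 + Real.sin p * Real.sin (q - p)) := by
    rw [← hs2, show (4 : ℝ) = 2 ^ 2 by norm_num, ← mul_pow]; gcongr
  constructor
  · rw [div_le_div_iff₀ (by norm_num) (by positivity), mul_assoc]
    exact mul_le_mul_of_nonneg_left (by linarith) (by positivity)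
  · rw [div_le_div_iff₀ (by positivity) (by norm_num), mul_assoc]
    exact mul_le_mul_of_nonneg_left (by linarith) (by positivity)
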